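/- Let $\mathcal{A}$ be a finite non-empty set of actions and $\mathcal{V}$ a countably infinite set of variables. Terms of $\mathrm{BCCSP}_\|$ are given by $$t ::= \mathbf{0} \mid x \mid a.t \mid t+t \mid t\,\|\,t \qquad (a\in\mathcal{A},\ x\in\mathcal{V});$$ a process is a closed term, i.e. one without variables. (Prefixing binds strongest, $+$ weakest; $\sum_{i=1}^k t_i$ is $t_1+\dots+t_k$, and $\mathbf{0}$ if $k=0$.) Transitions $p\xrightarrow{a}p'$ between processes are generated by the rules: $a.p\xrightarrow{a}p$; if $p\xrightarrow{a}p'$ then $p+q\xrightarrow{a}p'$, $q+p\xrightarrow{a}p'$, $p\,\|\,q\xrightarrow{a}p'\,\|\,q$ and $q\,\|\,p\xrightarrow{a}q\,\|\,p'$. Write $I(p)=\{a\mid \exists p'.\ p\xrightarrow{a}p'\}$, and $p\xrightarrow{\alpha}q$ if there is a sequence of transitions from $p$ to $q$ labelled by the word $\alpha\in\mathcal{A}^*$. Define - $\mathtt{RT}(p)$: the set of sequences $X_0a_1X_1\dots a_nX_n$ (with $n\ge 0$, $X_i\subseteq\mathcal{A}$, $a_i\in\mathcal{A}$) for which there are $p=p_0\xrightarrow{a_1}p_1\cdots\xrightarrow{a_n}p_n$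 with $I(p_i)=X_i$ for all $0\le i\le n$; - $\mathtt{FT}(p)$: the same with $I(p_i)\cap X_i=\emptyset$ in place of $I(p_i)=X_i$; - $\mathtt{R}(p)$: the set of pairs $(\alpha,X)$, $\alpha\in\mathcal{A}^*$, $X\subseteq\mathcal{A}$, such that $p\xrightarrow{\alpha}q$ for some $q$ with $I(q)=X$; - $\mathtt{F}(p)$: the same with $I(q)\cap X=\emptyset$ in place of $I(q)=X$. For $\mathtt{X}\in\{\mathtt{RT},\mathtt{FT},\mathtt{R},\mathtt{F}\}$ put $p\sim_{\mathtt{X}}q$ iff $\mathtt{X}(p)=\mathtt{X}(q)$ (ready trace, failure trace, readiness and failures equivalence). Consider the following equations, where each schema stands for all its instances with $a,b,a_i,b_j\in\mathcal{A}$, and $x,y,z,w,x_i,y_j$ are distinct variables: - (A0) $x+\mathbf{0}\approx x$; (A1) $x+y\approx y+x$; (A2) $(x+y)+z\approx x+(y+z)$; (A3) $x+x\approx x$; (P0) $x\,\|\,\mathbf{0}\approx x$; (P1) $x\,\|\,y\approx y\,\|\,x$; - (EL2) $\sum_{i\in I}a_ix_i\,\|\,\sum_{j\in J}b_jy_j\approx\sum_{i\in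 I}a_i\bigl(x_i\,\|\,\sum_{j\in J}b_jy_j\bigr)+\sum_{j\in J}b_j\bigl(\sum_{i\in I}a_ix_i\,\|\,y_j\bigr)$, with $I=\{1,\dots,k\}$, $J=\{1,\dots,m\}$, $k,m\ge 0$, the $a_i$ pairwise distinct and the $b_j$ pairwise distinct; - (FP) $(ax+ay+w)\,\|\,z\approx(ax+w)\,\|\,z+(ay+w)\,\|\,z$; - (RT) $a\bigl(\sum_{i=1}^{|\mathcal{A}|}(b_ix_i+b_iy_i)+z\bigr)\approx a\bigl(\sum_{i=1}^{|\mathcal{A}|}b_ix_i+z\bigr)+a\bigl(\sum_{i=1}^{|\mathcal{A}|}b_iy_i+z\bigr)$, where the $b_i$ need not be distinct; - (FT) $ax+ay\approx ax+ay+a(x+y)$; (RS) $a(bx+by+z)\approx a(bx+by+z)+a(bx+z)$; - (R) $a(bx+z)+a(by+w)\approx a(bx+by+z)+a(by+w)$; (F) $ax+a(y+z)\approx ax+a(x+y)+a(y+z)$. Let $\mathcal{E}_1=\{\mathrm{A0},\mathrm{A1},\mathrm{A2},\mathrm{A3},\mathrm{P0},\mathrm{P1}\}$ and $$\mathcal{E}_{\mathtt{RT}}=\mathcal{E}_1\cup\{\mathrm{RT},\mathrm{FP},\mathrm{EL2}\},\quad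 \mathcal{E}_{\mathtt{FT}}=\mathcal{E}_1\cup\{\mathrm{FT},\mathrm{RS},\mathrm{FP},\mathrm{EL2}\},\quad \mathcal{E}_{\mathtt{R}}=\mathcal{E}_1\cup\{\mathrm{R},\mathrm{FP},\mathrm{EL2}\},\quad \mathcal{E}_{\mathtt{F}}=\mathcal{E}_1\cup\{\mathrm{F},\mathrm{R},\mathrm{FP},\mathrm{EL2}\}.$$ Write $\mathcal{E}\vdash t\approx u$ if $t\approx u$ can be inferred from the equations in $\mathcal{E}$ by reflexivity, symmetry, transitivity, substitution (of terms for variables) and closure under the operators $a.\_$, $+$ and $\|$. **Theorem.** Let $\mathtt{X}\in\{\mathtt{RT},\mathtt{FT},\mathtt{R},\mathtt{F}\}$. The axiom system $\mathcal{E}_{\mathtt{X}}$ is a finite, sound and ground-complete axiomatisation of $\mathrm{BCCSP}_\|$ modulo $\sim_{\mathtt{X}}$. That is: $\mathcal{E}_{\mathtt{X}}$ is a finite set of equations; $\sigma(t)\sim_{\mathtt{X}}\sigma(u)$ for every equation $t\approx u$ in $\mathcal{E}_{\mathtt{X}}$ and every substitution $\sigma$ of processes for variables; $p\sim_{\mathtt{X}}q$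 implies $\mathcal{E}_{\mathtt{X}}\vdash p\approx q$ for all processes $p,q$; and hence, for all processes $p,q$, $$p\sim_{\mathtt{X}}q\quad\Longleftrightarrow\quad\mathcal{E}_{\mathtt{X}}\vdash p\approx q.$$ -/

import Mathlib

namespace BCCSPpar

universe u

/-- Terms over the action set `A`, with variables named by natural numbers:
`t ::= 0 | x | a.t | t + t | t ‖ t`. -/
inductive Term (A : Type u) : Type u
  | nil : Term A
  | var : ℕ → Term A
  | act : A → Term A → Term A
  | alt : Term A → Term A → Term A
  | par : Term A → Term A → Term A

namespace Term

variable {A : Type u}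

/-- The variables occurring in a term. -/
def vars : Term A → Set ℕ
  | nil => ∅
  | var x => {x}
  | act _ t => t.vars
  | alt t v => t.vars ∪ v.vars
  | par t v => t.vars ∪ v.vars

/-- Closed terms (processes) are the terms without variables. -/
def Closed (t : Term A) : Prop := t.vars = ∅

/-- Application of a substitution. -/
def subst (σ : ℕ → Term A) : Term A → Term A
  | nil => nil
  | var x => σ x
  | act a t => act a (t.subst σ)
  | alt t v => alt (t.subst σ) (v.subst σ)
  | par t v => par (t.subst σ) (v.subst σ)

/-- The summation `t₁ + (t₂ + (⋯ + tₖ))` of a list of terms; the empty sum is `0`. -/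
def listSum : List (Term A) → Term A
  | [] => nil
  | [t] => t
  | t :: v :: l => alt t (listSum (v :: l))

/-- The summation of a finite family of terms. -/
def sum {k : ℕ} (t : Fin k → Term A) : Term A := listSum (List.ofFn t)

end Term

section Semantics

variable {A : Type u}

/-- The transition relation, generated by the rules of the structural operational semantics. -/
inductive Step : Term A → A → Term A → Prop
  | act (a : A) (p : Term A) : Step (Term.act a p) a p
  | altLeft {p p' : Term A} {a : A} (q : Term A) (h : Step p a p') :
      Step (Term.alt p q) a p'
  | altRight {q q' : Term A} {a : A} (p : Term A) (h : Step q a q') :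
      Step (Term.alt p q) a q'
  | parLeft {p p' : Term A} {a : A} (q : Term A) (h : Step p a p') :
      Step (Term.par p q) a (Term.par p' q)
  | parRight {q q' : Term A} {a : A} (p : Term A) (h : Step q a q') :
      Step (Term.par p q) a (Term.par p q')

/-- Processes only move to processes. -/
theorem Step.closed {p p' : Term A} {a : A} (h : Step p a p') (hp : p.Closed) :
    p'.Closed := by
  induction h with
  | act a p => exact hp
  | altLeft q h ih => exact ih (Set.union_empty_iff.1 hp).1
  | altRight p h ih => exact ih (Set.union_empty_iff.1 hp).2
  | parLeft q h ih =>
      have hp := Set.union_empty_iff.1 hp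
      exact Set.union_empty_iff.2 ⟨ih hp.1, hp.2⟩
  | parRight p h ih =>
      have hp := Set.union_empty_iff.1 hp
      exact Set.union_empty_iff.2 ⟨hp.1, ih hp.2⟩

/-- The set `I(p)` of initial actions. -/
def initials (p : Term A) : Set A := {a | ∃ p', Step p a p'}

/-- `Steps p α q`: there are transitions from `p` to `q` labelled by the sequence `α`. -/
def Steps (p : Term A) : List A → Term A → Prop
  | [], q => p = q
  | a :: α, q => ∃ p', Step p a p' ∧ Steps p' α q

/-- Failure pairs. -/
def failurePairs (p : Term A) : Set (List A × Set A) :=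
  {x | ∃ q, Steps p x.1 q ∧ initials q ∩ x.2 = ∅}

/-- Ready pairs. -/
def readyPairs (p : Term A) : Set (List A × Set A) :=
  {x | ∃ q, Steps p x.1 q ∧ initials q = x.2}

/-- `IsFailureTrace p X₀ [(a₁, X₁), …, (aₙ, Xₙ)]`: there are transitions
`p = p₀ →[a₁] p₁ ⋯ →[aₙ] pₙ` with `I(pᵢ) ∩ Xᵢ = ∅` for all `0 ≤ i ≤ n`. -/
def IsFailureTrace (p : Term A) (X : Set A) : List (A × Set A) → Prop
  | [] => initials p ∩ X = ∅
  | (a, Y) :: l => initials p ∩ X = ∅ ∧ ∃ p', Step p a p' ∧ IsFailureTrace p' Y l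

/-- `IsReadyTrace p X₀ [(a₁, X₁), …, (aₙ, Xₙ)]`: there are transitions
`p = p₀ →[a₁] p₁ ⋯ →[aₙ] pₙ` with `I(pᵢ) = Xᵢ` for all `0 ≤ i ≤ n`. -/
def IsReadyTrace (p : Term A) (X : Set A) : List (A × Set A) → Prop
  | [] => initials p = X
  | (a, Y) :: l => initials p = X ∧ ∃ p', Step p a p' ∧ IsReadyTrace p' Y l

/-- Failure traces; the sequence `X₀ a₁ X₁ … aₙ Xₙ` is the pair of `X₀` and
`[(a₁, X₁), …, (aₙ, Xₙ)]`. -/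
def failureTraces (p : Term A) : Set (Set A × List (A × Set A)) :=
  {x | IsFailureTrace p x.1 x.2}

/-- Ready traces. -/
def readyTraces (p : Term A) : Set (Set A × List (A × Set A)) :=
  {x | IsReadyTrace p x.1 x.2}

end Semantics

section Logic

variable {A : Type u}

/-- The equation `t ≈ v`. -/
abbrev Equation (A : Type u) : Type u := Term A × Term A

/-- Derivability in equational logic from the axiom system `E`. -/
inductive Derives (E : Set (Equation A)) : Term A → Term A → Prop
  | ax {t v : Term A} (h : (t, v) ∈ E) : Derives E t v
  | refl (t : Term A) : Derives E t t
  | symm {t v : Term A} (h : Derives E t v) : Derives E v t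
  | trans {t v w : Term A} (h : Derives E t v) (h' : Derives E v w) : Derives E t w
  | subst {t v : Term A} (σ : ℕ → Term A) (h : Derives E t v) :
      Derives E (t.subst σ) (v.subst σ)
  | act {t v : Term A} (a : A) (h : Derives E t v) :
      Derives E (Term.act a t) (Term.act a v)
  | alt {t v t' v' : Term A} (h : Derives E t v) (h' : Derives E t' v') :
      Derives E (Term.alt t t') (Term.alt v v')
  | par {t v t' v' : Term A} (h : Derives E t v) (h' : Derives E t' v') :
      Derives E (Term.par t t') (Term.par v v')

/-- All closed instances of all equations of `E` are valid modulo `R`. -/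
def Sound (E : Set (Equation A)) (R : Term A → Term A → Prop) : Prop :=
  ∀ e ∈ E, ∀ σ : ℕ → Term A, (∀ x, (σ x).Closed) → R (e.1.subst σ) (e.2.subst σ)

/-- Every equation between closed terms that is valid modulo `R` is derivable from `E`. -/
def GroundComplete (E : Set (Equation A)) (R : Term A → Term A → Prop) : Prop :=
  ∀ p q : Term A, p.Closed → q.Closed → R p q → Derives E p q

end Logic

section Axioms

open Term

variable (A : Type u)

/-- The basic axioms `A0`, `A1`, `A2`, `A3`. -/
def axE0 : Set (Equation A) :=
  { (alt (var 0) nil, var 0),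
    (alt (var 0) (var 1), alt (var 1) (var 0)),
    (alt (alt (var 0) (var 1)) (var 2), alt (var 0) (alt (var 1) (var 2))),
    (alt (var 0) (var 0), var 0) }

/-- The basic axioms together with `P0` and `P1`. -/
def axE1 : Set (Equation A) :=
  axE0 A ∪
  { (par (var 0) nil, var 0),
    (par (var 0) (var 1), par (var 1) (var 0)) }

/-- The restricted expansion law
`∑ aᵢxᵢ ‖ ∑ bⱼyⱼ ≈ ∑ aᵢ(xᵢ ‖ ∑ bⱼyⱼ) + ∑ bⱼ(∑ aᵢxᵢ ‖ yⱼ)`,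
for pairwise distinct actions `aᵢ` and pairwise distinct actions `bⱼ`.
The variables `xᵢ` have even names, the variables `yⱼ` have odd names. -/
def axEL2 : Set (Equation A) :=
  {e | ∃ (k m : ℕ) (a : Fin k → A) (b : Fin m → A),
    Function.Injective a ∧ Function.Injective b ∧
    e = (par (sum fun i => act (a i) (var (2 * i)))
             (sum fun j => act (b j) (var (2 * j + 1))),
         alt (sum fun i => act (a i)
                (par (var (2 * i)) (sum fun j => act (b j) (var (2 * j + 1)))))
             (sum fun j => act (b j)
                (par (sum fun i => act (a i) (var (2 * i))) (var (2 * j + 1)))))}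

/-- `(ax + ay + w) ‖ z ≈ (ax + w) ‖ z + (ay + w) ‖ z`, for all actions `a`. -/
def axFP : Set (Equation A) :=
  {e | ∃ a : A,
    e = (par (alt (alt (act a (var 0)) (act a (var 1))) (var 2)) (var 3),
         alt (par (alt (act a (var 0)) (var 2)) (var 3))
             (par (alt (act a (var 1)) (var 2)) (var 3)))}

/-- `a(∑ (bᵢxᵢ + bᵢyᵢ) + z) ≈ a(∑ bᵢxᵢ + z) + a(∑ bᵢyᵢ + z)`, for all actions `a` and all
families `b₁, …, bₙ` of `n = |A|` actions, not necessarily distinct.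
Here `z`, `xᵢ`, `yᵢ` are the variables named `0`, `2i + 1`, `2i + 2`. -/
def axRT [Fintype A] : Set (Equation A) :=
  {e | ∃ (a : A) (b : Fin (Fintype.card A) → A),
    e = (act a (alt (sum fun i => alt (act (b i) (var (2 * i + 1)))
                                      (act (b i) (var (2 * i + 2)))) (var 0)),
         alt (act a (alt (sum fun i => act (b i) (var (2 * i + 1))) (var 0)))
             (act a (alt (sum fun i => act (b i) (var (2 * i + 2))) (var 0))))}

/-- `ax + ay ≈ ax + ay + a(x + y)`, for all actions `a`. -/
def axFT : Set (Equation A) :=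
  {e | ∃ a : A,
    e = (alt (act a (var 0)) (act a (var 1)),
         alt (alt (act a (var 0)) (act a (var 1))) (act a (alt (var 0) (var 1))))}

/-- `a(bx + by + z) ≈ a(bx + by + z) + a(bx + z)`, for all actions `a`, `b`. -/
def axRS : Set (Equation A) :=
  {e | ∃ a b : A,
    e = (act a (alt (alt (act b (var 0)) (act b (var 1))) (var 2)),
         alt (act a (alt (alt (act b (var 0)) (act b (var 1))) (var 2)))
             (act a (alt (act b (var 0)) (var 2))))}

/-- `a(bx + z) + a(by + w) ≈ a(bx + by + z) + a(by + w)`, for all actions `a`, `b`. -/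
def axR : Set (Equation A) :=
  {e | ∃ a b : A,
    e = (alt (act a (alt (act b (var 0)) (var 2))) (act a (alt (act b (var 1)) (var 3))),
         alt (act a (alt (alt (act b (var 0)) (act b (var 1))) (var 2)))
             (act a (alt (act b (var 1)) (var 3))))}

/-- `ax + a(y + z) ≈ ax + a(x + y) + a(y + z)`, for all actions `a`. -/
def axF : Set (Equation A) :=
  {e | ∃ a : A,
    e = (alt (act a (var 0)) (act a (alt (var 1) (var 2))),
         alt (alt (act a (var 0)) (act a (alt (var 0) (var 1))))
             (act a (alt (var 1) (var 2))))}

/-- Ready trace, failure trace, readiness and failures semantics. -/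
inductive Sem : Type
  | RT | FT | R | F

/-- The axiom systems `E_RT`, `E_FT`, `E_R` and `E_F`. -/
def axSystem [Fintype A] : Sem → Set (Equation A)
  | Sem.RT => axE1 A ∪ axRT A ∪ axFP A ∪ axEL2 A
  | Sem.FT => axE1 A ∪ axFT A ∪ axRS A ∪ axFP A ∪ axEL2 A
  | Sem.R => axE1 A ∪ axR A ∪ axFP A ∪ axEL2 A
  | Sem.F => axE1 A ∪ axF A ∪ axR A ∪ axFP A ∪ axEL2 A

variable {A}

/-- Ready trace, failure trace, readiness and failures equivalence. -/
def SemEquiv : Sem → Term A → Term A → Prop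
  | Sem.RT, p, q => readyTraces p = readyTraces q
  | Sem.FT, p, q => failureTraces p = failureTraces q
  | Sem.R, p, q => readyPairs p = readyPairs q
  | Sem.F, p, q => failurePairs p = failurePairs q

end Axioms

end BCCSPpar

/-! Soundness. Variables have no transitions, so the four equivalences make sense on open terms, and
each is a congruence there for all operators. Hence it suffices to check the axioms, under arbitrary
substitutions. Ready trace equivalence implies the other three, so the basic axioms, FP and EL2 need
checking for ready traces only.

Ground-completeness. Modulo A0-A3, terms form a join-semilattice with least element `0`, where x ≤ y
means that y absorbs x as a summand. FP splits a parallel composition until the summands of each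
operand have distinct actions, and then EL2 expands it; induction on the number of prefixes removes
‖ from closed terms (`exists_basic`).

For terms p, q without ‖ the argument is by induction on depth (`cls_eq_of_absorption`). Given a
summand aq' of q, equivalent terms P, Q of smaller depth than p and q are found with aq' ≤ aQ and aP
≤ p; by induction P and Q are provably equal, so aq' ≤ p. For the two trace semantics, P and Q are
the sums of the a-derivatives of p and q whose initials equal (RT) or are contained in (FT) I(q').
For readiness and failures, they are the sums of all br with b in I(q') such that r is reached by a
followed by b. The inequality aq' ≤ aQ comes from the saturation law a(bx + z) ≤ a(bx + by + z),
which every system proves; aP ≤ p comes from a merging law specific to each system. The merging law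
for RT, `pre_val_sup_le_of_axRT`, takes the most work. -/

namespace BCCSPpar

universe u

variable {A : Type u}

open Term

/-! ### Substitutions and transitions -/

section Substitution

theorem Term.subst_subst (t : Term A) (τ σ : ℕ → Term A) :
    (t.subst τ).subst σ = t.subst fun x => (τ x).subst σ := by
  induction t <;> simp_all [Term.subst]

theorem Term.subst_var (t : Term A) : t.subst Term.var = t := by
  induction t <;> simp_all [Term.subst]

theorem Term.subst_listSum (σ : ℕ → Term A) (l : List (Term A)) :
    (listSum l).subst σ = listSum (l.map (Term.subst σ)) := by
  induction l with
  | nil => rfl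
  | cons t l ih =>
    cases l with
    | nil => rfl
    | cons v l => simpa [listSum, Term.subst] using ih

theorem Term.subst_sum (σ : ℕ → Term A) {k : ℕ} (t : Fin k → Term A) :
    (sum t).subst σ = sum fun i => (t i).subst σ := by
  simp [sum, subst_listSum, List.map_ofFn, Function.comp_def]

end Substitution

section Transitions

@[simp] theorem step_nil {c : A} {r : Term A} : Step nil c r ↔ False :=
  ⟨fun h => (nomatch h), False.elim⟩

@[simp] theorem step_act {a c : A} {p r : Term A} : Step (act a p) c r ↔ c = a ∧ r = p :=
  ⟨fun h => by cases h; exact ⟨rfl, rfl⟩, fun ⟨h, h'⟩ => by subst h h'; exact .act _ _⟩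

@[simp] theorem step_alt {p q r : Term A} {c : A} :
    Step (alt p q) c r ↔ Step p c r ∨ Step q c r :=
  ⟨fun h => by cases h with
    | altLeft _ h => exact .inl h
    | altRight _ h => exact .inr h,
   fun h => h.elim (.altLeft _) (.altRight _)⟩

theorem step_par {p q r : Term A} {c : A} :
    Step (par p q) c r ↔
      (∃ p', Step p c p' ∧ r = par p' q) ∨ ∃ q', Step q c q' ∧ r = par p q' :=
  ⟨fun h => by cases h with
    | parLeft _ h => exact .inl ⟨_, h, rfl⟩
    | parRight _ h => exact .inr ⟨_, h, rfl⟩,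
   fun h => by
    rcases h with ⟨p', h, rfl⟩ | ⟨q', h, rfl⟩
    · exact .parLeft _ h
    · exact .parRight _ h⟩

theorem step_listSum {l : List (Term A)} {c : A} {r : Term A} :
    Step (listSum l) c r ↔ ∃ t ∈ l, Step t c r := by
  induction l with
  | nil => simp [listSum]
  | cons t l ih =>
    cases l with
    | nil => simp [listSum]
    | cons v l => simp only [listSum, step_alt, ih, List.exists_mem_cons_iff]

theorem step_sum {k : ℕ} {t : Fin k → Term A} {c : A} {r : Term A} :
    Step (sum t) c r ↔ ∃ i, Step (t i) c r := by
  simp [sum, step_listSum, List.mem_ofFn]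

@[simp] theorem initials_act (a : A) (p : Term A) : initials (act a p) = {a} := by
  ext c; simp [initials]

@[simp] theorem initials_alt (p q : Term A) :
    initials (alt p q) = initials p ∪ initials q := by
  ext c; simp [initials, exists_or]

@[simp] theorem initials_par (p q : Term A) :
    initials (par p q) = initials p ∪ initials q := by
  ext c
  simp only [initials, Set.mem_ofPred_eq, Set.mem_union, step_par]
  constructor
  · rintro ⟨_, ⟨p', h, _⟩ | ⟨q', h, _⟩⟩
    exacts [.inl ⟨_, h⟩, .inr ⟨_, h⟩]
  · rintro (⟨p', h⟩ | ⟨q', h⟩)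
    exacts [⟨_, .inl ⟨_, h, rfl⟩⟩, ⟨_, .inr ⟨_, h, rfl⟩⟩]

theorem initials_mono {p q : Term A} (h : ∀ c r, Step p c r → Step q c r) :
    initials p ⊆ initials q :=
  fun c ⟨r, hr⟩ => ⟨r, h c r hr⟩

theorem initials_congr {p q : Term A} (h : ∀ c r, Step p c r ↔ Step q c r) :
    initials p = initials q :=
  (initials_mono fun c r => (h c r).1).antisymm (initials_mono fun c r => (h c r).2)

end Transitions

/-! ### Ready traces, and how they determine the other semantics -/

section ReadyTraces

theorem IsReadyTrace.initials_eq {p : Term A} {X : Set A} {l : List (A × Set A)}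
    (h : IsReadyTrace p X l) : initials p = X := by
  cases l with
  | nil => exact h
  | cons x l => exact h.1

theorem isReadyTrace_nil (p : Term A) : IsReadyTrace p (initials p) [] := rfl

theorem initials_eq_of_readyTraces {p q : Term A} (h : readyTraces p = readyTraces q) :
    initials p = initials q :=
  ((Set.ext_iff.1 h (initials p, [])).1 (isReadyTrace_nil p)).symm

theorem readyTraces_ext {p q : Term A}
    (h : ∀ X l, IsReadyTrace p X l ↔ IsReadyTrace q X l) : readyTraces p = readyTraces q :=
  Set.ext fun x => h x.1 x.2

theorem readyTraces_iff {p q : Term A} (h : readyTraces p = readyTraces q) (X : Set A)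
    (l : List (A × Set A)) : IsReadyTrace p X l ↔ IsReadyTrace q X l :=
  Set.ext_iff.1 h (X, l)

/-- Bisimilar terms have the same ready traces. -/
theorem readyTraces_eq_of_bisim (S : Term A → Term A → Prop)
    (h₁ : ∀ p q a p', S p q → Step p a p' → ∃ q', Step q a q' ∧ S p' q')
    (h₂ : ∀ p q a q', S p q → Step q a q' → ∃ p', Step p a p' ∧ S p' q')
    {p q : Term A} (h : S p q) : readyTraces p = readyTraces q := by
  refine readyTraces_ext fun X l => ?_
  have hI : ∀ p q, S p q → initials p = initials q := fun p q h => Set.ext fun a =>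
    ⟨fun ⟨p', hp⟩ => let ⟨q', hq, _⟩ := h₁ p q a p' h hp; ⟨q', hq⟩,
     fun ⟨q', hq⟩ => let ⟨p', hp, _⟩ := h₂ p q a q' h hq; ⟨p', hp⟩⟩
  induction l generalizing p q X with
  | nil => simp [IsReadyTrace, hI p q h]
  | cons x l ih =>
    obtain ⟨a, Y⟩ := x
    simp only [IsReadyTrace, hI p q h]
    refine and_congr_right fun _ => ⟨?_, ?_⟩
    · rintro ⟨p', hp, ht⟩
      obtain ⟨q', hq, hS⟩ := h₁ p q a p' h hp
      exact ⟨q', hq, (ih hS Y).1 ht⟩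
    · rintro ⟨q', hq, ht⟩
      obtain ⟨p', hp, hS⟩ := h₂ p q a q' h hq
      exact ⟨p', hp, (ih hS Y).2 ht⟩

theorem readyTraces_eq_of_step {p q : Term A} (h : ∀ c r, Step p c r ↔ Step q c r) :
    readyTraces p = readyTraces q := by
  refine readyTraces_ext fun X l => ?_
  cases l with
  | nil => simp [IsReadyTrace, initials_congr h]
  | cons x l => simp [IsReadyTrace, initials_congr h, h]

/-- The first set of a ready trace cannot tell the `t i` from `p`, and the first step already lies
in one of the `t i`. Soundness of RT and FP rests on this distributivity. -/
theorem isReadyTrace_of_step_iff {ι : Type*} [Nonempty ι] {p : Term A} {t : ι → Term A}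
    (h : ∀ c r, Step p c r ↔ ∃ i, Step (t i) c r) (hI : ∀ i, initials (t i) = initials p)
    (X : Set A) (l : List (A × Set A)) :
    IsReadyTrace p X l ↔ ∃ i, IsReadyTrace (t i) X l := by
  cases l with
  | nil => simp [IsReadyTrace, hI]
  | cons x l =>
    simp only [IsReadyTrace, hI, h]
    constructor
    · rintro ⟨h₁, r, ⟨i, hi⟩, h₂⟩
      exact ⟨i, h₁, r, hi, h₂⟩
    · rintro ⟨i, h₁, r, hi, h₂⟩
      exact ⟨h₁, r, ⟨i, hi⟩, h₂⟩

theorem isReadyTrace_alt {p q : Term A} (hI : initials p = initials q)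
    (X : Set A) (l : List (A × Set A)) :
    IsReadyTrace (alt p q) X l ↔ IsReadyTrace p X l ∨ IsReadyTrace q X l := by
  have := isReadyTrace_of_step_iff (p := alt p q) (t := fun b : Bool => cond b p q)
    (fun c r => by simp [or_comm]) (fun b => by cases b <;> simp [hI]) X l
  simpa [or_comm] using this

end ReadyTraces

section Comparison

/-- Ready traces determine failure traces. -/
theorem isFailureTrace_iff (p : Term A) (X : Set A) (l : List (A × Set A)) :
    IsFailureTrace p X l ↔ ∃ Y m, IsReadyTrace p Y m ∧ Y ∩ X = ∅ ∧
      List.Forall₂ (fun x y : A × Set A => x.1 = y.1 ∧ x.2 ∩ y.2 = ∅) m l := by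
  induction l generalizing p X with
  | nil => simp [IsFailureTrace, IsReadyTrace]
  | cons x l ih =>
    obtain ⟨a, Z⟩ := x
    simp only [IsFailureTrace, ih, List.forall₂_cons_right_iff]
    constructor
    · rintro ⟨hX, p', hp, Y, m, ht, hY, hm⟩
      exact ⟨_, (a, Y) :: m, ⟨rfl, p', hp, ht⟩, hX, (a, Y), m, ⟨rfl, hY⟩, hm, rfl⟩
    · rintro ⟨Y, _, ht, hX, ⟨b, W⟩, m, ⟨rfl, hW⟩, hm, rfl⟩
      obtain ⟨rfl, p', hp, ht⟩ := ht
      exact ⟨hX, p', hp, W, m, ht, hW, hm⟩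

/-- Ready traces determine ready pairs. -/
theorem steps_iff (p : Term A) (α : List A) (X : Set A) :
    (∃ q, Steps p α q ∧ initials q = X) ↔
      ∃ Y m, IsReadyTrace p Y m ∧ m.map Prod.fst = α ∧
        ((Y :: m.map Prod.snd).getLast (by simp)) = X := by
  induction α generalizing p with
  | nil =>
    simp [Steps, IsReadyTrace]
  | cons a α ih =>
    constructor
    · rintro ⟨q, ⟨p', hp, hs⟩, hq⟩
      obtain ⟨Y, m, ht, hm, hl⟩ := (ih p').1 ⟨q, hs, hq⟩
      exact ⟨_, (a, Y) :: m, ⟨rfl, p', hp, ht⟩, by simp [hm], by simpa using hl⟩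
    · rintro ⟨Y, m, ht, hm, hl⟩
      cases m with
      | nil => simp at hm
      | cons x m =>
        obtain ⟨b, Z⟩ := x
        simp only [List.map_cons, List.cons.injEq] at hm
        obtain ⟨rfl, hm⟩ := hm
        obtain ⟨-, p', hp, ht⟩ := ht
        obtain ⟨q, hs, hq⟩ := (ih p').2 ⟨Z, m, ht, hm, by simpa using hl⟩
        exact ⟨q, ⟨p', hp, hs⟩, hq⟩

theorem failurePairs_eq_of_readyPairs {p q : Term A} (h : readyPairs p = readyPairs q) :
    failurePairs p = failurePairs q := by
  have key : ∀ p : Term A,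
      failurePairs p = {x | ∃ Y, (x.1, Y) ∈ readyPairs p ∧ Y ∩ x.2 = ∅} := fun p => by
    ext x
    exact ⟨fun ⟨r, hr, hx⟩ => ⟨initials r, ⟨r, hr, rfl⟩, hx⟩,
      fun ⟨Y, ⟨r, hr, hY⟩, hx⟩ => ⟨r, hr, hY.symm ▸ hx⟩⟩
  rw [key, key, h]

theorem readyPairs_eq_of_readyTraces {p q : Term A} (h : readyTraces p = readyTraces q) :
    readyPairs p = readyPairs q := by
  ext x
  simp only [readyPairs, Set.mem_ofPred_eq, steps_iff, readyTraces_iff h]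

theorem failureTraces_eq_of_readyTraces {p q : Term A} (h : readyTraces p = readyTraces q) :
    failureTraces p = failureTraces q := by
  ext x
  simp only [failureTraces, Set.mem_ofPred_eq, isFailureTrace_iff, readyTraces_iff h]

theorem semEquiv_of_readyTraces {p q : Term A} (h : readyTraces p = readyTraces q) (X : Sem) :
    SemEquiv X p q := by
  cases X
  exacts [h, failureTraces_eq_of_readyTraces h, readyPairs_eq_of_readyTraces h,
    failurePairs_eq_of_readyPairs (readyPairs_eq_of_readyTraces h)]

end Comparison

/-! ### Ready pairs and failure pairs, step by step -/

section Pairs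

theorem nil_mem_readyPairs {p : Term A} {X : Set A} :
    ([], X) ∈ readyPairs p ↔ initials p = X := by
  simp [readyPairs, Steps]

theorem cons_mem_readyPairs {p : Term A} {a : A} {α : List A} {X : Set A} :
    (a :: α, X) ∈ readyPairs p ↔ ∃ p', Step p a p' ∧ (α, X) ∈ readyPairs p' := by
  simp only [readyPairs, Steps, Set.mem_ofPred_eq]
  exact ⟨fun ⟨q, ⟨p', h, h'⟩, hq⟩ => ⟨p', h, q, h', hq⟩,
    fun ⟨p', h, q, h', hq⟩ => ⟨q, ⟨p', h, h'⟩, hq⟩⟩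

theorem nil_mem_failurePairs {p : Term A} {X : Set A} :
    ([], X) ∈ failurePairs p ↔ initials p ∩ X = ∅ := by
  simp [failurePairs, Steps]

theorem cons_mem_failurePairs {p : Term A} {a : A} {α : List A} {X : Set A} :
    (a :: α, X) ∈ failurePairs p ↔ ∃ p', Step p a p' ∧ (α, X) ∈ failurePairs p' := by
  simp only [failurePairs, Steps, Set.mem_ofPred_eq]
  exact ⟨fun ⟨q, ⟨p', h, h'⟩, hq⟩ => ⟨p', h, q, h', hq⟩,
    fun ⟨p', h, q, h', hq⟩ => ⟨q, ⟨p', h, h'⟩, hq⟩⟩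

theorem readyPairs_ext {p q : Term A}
    (h : ∀ α X, (α, X) ∈ readyPairs p ↔ (α, X) ∈ readyPairs q) :
    readyPairs p = readyPairs q :=
  Set.ext fun x => h x.1 x.2

theorem failurePairs_ext {p q : Term A}
    (h : ∀ α X, (α, X) ∈ failurePairs p ↔ (α, X) ∈ failurePairs q) :
    failurePairs p = failurePairs q :=
  Set.ext fun x => h x.1 x.2

theorem failureTraces_ext {p q : Term A}
    (h : ∀ X l, IsFailureTrace p X l ↔ IsFailureTrace q X l) :
    failureTraces p = failureTraces q :=
  Set.ext fun x => h x.1 x.2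

theorem failureTraces_iff {p q : Term A} (h : failureTraces p = failureTraces q) (X : Set A)
    (l : List (A × Set A)) : IsFailureTrace p X l ↔ IsFailureTrace q X l :=
  Set.ext_iff.1 h (X, l)

theorem initials_eq_of_readyPairs {p q : Term A} (h : readyPairs p = readyPairs q) :
    initials p = initials q :=
  (nil_mem_readyPairs.1 (h ▸ nil_mem_readyPairs.2 rfl)).symm

end Pairs

/-! ### The four equivalences are congruences -/

section Congruence

theorem SemEquiv.refl (X : Sem) (p : Term A) : SemEquiv X p p := by
  cases X <;> exact Eq.refl _

theorem SemEquiv.symm {X : Sem} {p q : Term A} (h : SemEquiv X p q) : SemEquiv X q p := by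
  cases X <;> exact Eq.symm h

theorem SemEquiv.trans {X : Sem} {p q r : Term A} (h : SemEquiv X p q) (h' : SemEquiv X q r) :
    SemEquiv X p r := by
  cases X <;> exact Eq.trans h h'

theorem SemEquiv.act {X : Sem} {p q : Term A} (a : A) (h : SemEquiv X p q) :
    SemEquiv X (act a p) (act a q) := by
  cases X with
  | RT =>
    refine readyTraces_ext fun X l => ?_
    cases l <;> simp [IsReadyTrace, and_assoc, readyTraces_iff h]
  | FT =>
    refine failureTraces_ext fun X l => ?_
    cases l <;> simp [IsFailureTrace, and_assoc, failureTraces_iff h]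
  | R =>
    refine readyPairs_ext fun α X => ?_
    have h : readyPairs p = readyPairs q := h
    cases α <;> simp [nil_mem_readyPairs, cons_mem_readyPairs, and_assoc, h]
  | F =>
    refine failurePairs_ext fun α X => ?_
    have h : failurePairs p = failurePairs q := h
    cases α <;> simp [nil_mem_failurePairs, cons_mem_failurePairs, and_assoc, h]

/-- Only the first set sees both summands; the remainder of the trace belongs to one of them, whose
own initials fill the first position. -/
theorem isReadyTrace_alt_iff {p q : Term A} (X : Set A) (l : List (A × Set A)) :
    IsReadyTrace (alt p q) X l ↔ initials p ∪ initials q = X ∧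
      (IsReadyTrace p (initials p) l ∨ IsReadyTrace q (initials q) l) := by
  cases l with
  | nil => simp [IsReadyTrace]
  | cons x l => simp [IsReadyTrace, or_and_right, exists_or]

theorem isFailureTrace_alt_iff {p q : Term A} (X : Set A) (l : List (A × Set A)) :
    IsFailureTrace (alt p q) X l ↔
      IsFailureTrace p X l ∧ IsFailureTrace q X [] ∨
      IsFailureTrace p X [] ∧ IsFailureTrace q X l := by
  cases l with
  | nil => simp [IsFailureTrace, Set.union_inter_distrib_right]
  | cons x l =>
    simp only [IsFailureTrace, initials_alt, step_alt, Set.union_inter_distrib_right,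
      Set.union_empty_iff, or_and_right, exists_or]
    grind

theorem SemEquiv.alt {X : Sem} {p q p' q' : Term A} (h : SemEquiv X p q)
    (h' : SemEquiv X p' q') : SemEquiv X (alt p p') (alt q q') := by
  cases X with
  | RT =>
    refine readyTraces_ext fun X l => ?_
    simp only [isReadyTrace_alt_iff, initials_eq_of_readyTraces h, initials_eq_of_readyTraces h',
      readyTraces_iff h, readyTraces_iff h']
  | FT =>
    refine failureTraces_ext fun X l => ?_
    simp only [isFailureTrace_alt_iff, failureTraces_iff h, failureTraces_iff h']
  | R =>
    refine readyPairs_ext fun α X => ?_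
    cases α with
    | nil =>
      simp [nil_mem_readyPairs, initials_eq_of_readyPairs h, initials_eq_of_readyPairs h']
    | cons a α =>
      have h : readyPairs p = readyPairs q := h
      have h' : readyPairs p' = readyPairs q' := h'
      simp only [cons_mem_readyPairs, step_alt, or_and_right, exists_or]
      rw [← cons_mem_readyPairs, ← cons_mem_readyPairs, h, h', cons_mem_readyPairs,
        cons_mem_readyPairs]
  | F =>
    refine failurePairs_ext fun α X => ?_
    have h : failurePairs p = failurePairs q := h
    have h' : failurePairs p' = failurePairs q' := h'
    cases α with
    | nil =>
      simp only [nil_mem_failurePairs, initials_alt, Set.union_inter_distrib_right,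
        Set.union_empty_iff]
      rw [← nil_mem_failurePairs, ← nil_mem_failurePairs, h, h', nil_mem_failurePairs,
        nil_mem_failurePairs]
    | cons a α =>
      simp only [cons_mem_failurePairs, step_alt, or_and_right, exists_or]
      rw [← cons_mem_failurePairs, ← cons_mem_failurePairs, h, h', cons_mem_failurePairs,
        cons_mem_failurePairs]

/-- A run of the composition reveals the trace of its left component only gradually, and which state
matches it on the other side depends on the whole run. So the induction carries the sets of all
states still possible; singletons give the congruence property. The three analogues below follow the
same plan. -/
theorem isReadyTrace_par_mono (P Q : Set (Term A)) (r : Term A) (X : Set A)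
    (l : List (A × Set A))
    (h : ∀ Y m, (∃ p ∈ P, IsReadyTrace p Y m) → ∃ q ∈ Q, IsReadyTrace q Y m)
    (hP : ∃ p ∈ P, IsReadyTrace (par p r) X l) : ∃ q ∈ Q, IsReadyTrace (par q r) X l := by
  induction l generalizing P Q r X with
  | nil =>
    obtain ⟨p, hp, hX⟩ := hP
    obtain ⟨q, hq, hI⟩ := h (initials p) [] ⟨p, hp, rfl⟩
    refine ⟨q, hq, ?_⟩
    simp only [IsReadyTrace, initials_par] at hX hI ⊢
    rw [hI, hX]
  | cons x l ih =>
    obtain ⟨a, Y⟩ := x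
    obtain ⟨p, hp, rfl, r', hr, ht⟩ := hP
    rcases step_par.1 hr with ⟨p', hp', rfl⟩ | ⟨r', hr', rfl⟩
    -- The left component moves: pass to the a-derivatives of those states with the observed
    -- initials.
    · obtain ⟨q', ⟨q, hq, hI, hq'⟩, ht'⟩ := ih
        {p' | ∃ s ∈ P, initials s = initials p ∧ Step s a p'}
        {q' | ∃ s ∈ Q, initials s = initials p ∧ Step s a q'} r Y (by
          rintro Z m ⟨t, ⟨s, hs, hI, hst⟩, ht⟩
          obtain ⟨q, hq, hIq, q', hq', htq⟩ := h (initials p) ((a, Z) :: m)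
            ⟨s, hs, hI, t, hst, ht⟩
          exact ⟨q', ⟨q, hq, hIq, hq'⟩, htq⟩) ⟨p', ⟨p, hp, rfl, hp'⟩, ht⟩
      exact ⟨q, hq, by simp [hI], _, .parLeft _ hq', ht'⟩
    -- The right component moves: the left states stay, filtered by the observed initials.
    · obtain ⟨q, ⟨hq, hI⟩, ht'⟩ := ih
        {s | s ∈ P ∧ initials s = initials p} {s | s ∈ Q ∧ initials s = initials p} r' Y (by
          rintro Z m ⟨s, ⟨hs, hI⟩, ht⟩
          obtain ⟨q, hq, hq'⟩ := h Z m ⟨s, hs, ht⟩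
          exact ⟨q, ⟨hq, by rw [hq'.initials_eq, ← ht.initials_eq, hI]⟩, hq'⟩)
        ⟨p, ⟨hp, rfl⟩, ht⟩
      exact ⟨q, hq, by simp [hI], _, .parRight _ hr', ht'⟩

theorem IsFailureTrace.inter_eq {p : Term A} {X : Set A} {l : List (A × Set A)}
    (h : IsFailureTrace p X l) : initials p ∩ X = ∅ := by
  cases l with
  | nil => exact h
  | cons x l => exact h.1

theorem isFailureTrace_union {p : Term A} {X Y : Set A} {l : List (A × Set A)} :
    IsFailureTrace p (X ∪ Y) l ↔ initials p ∩ X = ∅ ∧ IsFailureTrace p Y l := by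
  cases l <;> simp [IsFailureTrace, Set.inter_union_distrib_left, and_assoc]

theorem isFailureTrace_par_mono (P Q : Set (Term A)) (r : Term A) (X : Set A)
    (l : List (A × Set A))
    (h : ∀ Y m, (∃ p ∈ P, IsFailureTrace p Y m) → ∃ q ∈ Q, IsFailureTrace q Y m)
    (hP : ∃ p ∈ P, IsFailureTrace (par p r) X l) :
    ∃ q ∈ Q, IsFailureTrace (par q r) X l := by
  induction l generalizing P Q r X with
  | nil =>
    obtain ⟨p, hp, hX⟩ := hP
    simp only [IsFailureTrace, initials_par, Set.union_inter_distrib_right,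
      Set.union_empty_iff] at hX
    obtain ⟨q, hq, hI⟩ := h X [] ⟨p, hp, hX.1⟩
    refine ⟨q, hq, ?_⟩
    simp only [IsFailureTrace, initials_par, Set.union_inter_distrib_right,
      Set.union_empty_iff]
    exact ⟨hI, hX.2⟩
  | cons x l ih =>
    obtain ⟨a, Y⟩ := x
    obtain ⟨p, hp, hX, r', hr, ht⟩ := hP
    simp only [initials_par, Set.union_inter_distrib_right, Set.union_empty_iff] at hX
    rcases step_par.1 hr with ⟨p', hp', rfl⟩ | ⟨r', hr', rfl⟩
    · obtain ⟨q', ⟨q, hq, hI, hq'⟩, ht'⟩ := ih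
        {p' | ∃ s ∈ P, initials s ∩ X = ∅ ∧ Step s a p'}
        {q' | ∃ s ∈ Q, initials s ∩ X = ∅ ∧ Step s a q'} r Y (by
          rintro Z m ⟨t, ⟨s, hs, hI, hst⟩, ht⟩
          obtain ⟨q, hq, hIq, q', hq', htq⟩ := h X ((a, Z) :: m) ⟨s, hs, hI, t, hst, ht⟩
          exact ⟨q', ⟨q, hq, hIq, hq'⟩, htq⟩) ⟨p', ⟨p, hp, hX.1, hp'⟩, ht⟩
      exact ⟨q, hq, by simp [Set.union_inter_distrib_right, hI, hX.2], _, .parLeft _ hq', ht'⟩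
    · obtain ⟨q, ⟨hq, hI⟩, ht'⟩ := ih
        {s | s ∈ P ∧ initials s ∩ X = ∅} {s | s ∈ Q ∧ initials s ∩ X = ∅} r' Y (by
          rintro Z m ⟨s, ⟨hs, hI⟩, ht⟩
          -- The left component has not moved, so refusing X before and Z after the move on the
          -- right amounts to refusing their union in one state.
          obtain ⟨q, hq, hq'⟩ := h (X ∪ Z) m ⟨s, hs, isFailureTrace_union.2 ⟨hI, ht⟩⟩
          rw [isFailureTrace_union] at hq'
          exact ⟨q, ⟨hq, hq'.1⟩, hq'.2⟩) ⟨p, ⟨hp, hX.1⟩, ht⟩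
      exact ⟨q, hq, by simp [Set.union_inter_distrib_right, hI, hX.2], _, .parRight _ hr', ht'⟩

theorem readyPairs_par_mono (P Q : Set (Term A)) (r : Term A) (X : Set A) (α : List A)
    (h : ∀ β Y, (∃ p ∈ P, (β, Y) ∈ readyPairs p) → ∃ q ∈ Q, (β, Y) ∈ readyPairs q)
    (hP : ∃ p ∈ P, (α, X) ∈ readyPairs (par p r)) :
    ∃ q ∈ Q, (α, X) ∈ readyPairs (par q r) := by
  induction α generalizing P Q r with
  | nil =>
    obtain ⟨p, hp, hX⟩ := hP
    obtain ⟨q, hq, hI⟩ := h [] (initials p) ⟨p, hp, nil_mem_readyPairs.2 rfl⟩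
    refine ⟨q, hq, ?_⟩
    simp only [nil_mem_readyPairs, initials_par] at hX hI ⊢
    rw [hI, hX]
  | cons a α ih =>
    obtain ⟨p, hp, hX⟩ := hP
    obtain ⟨r', hr, ht⟩ := cons_mem_readyPairs.1 hX
    rcases step_par.1 hr with ⟨p', hp', rfl⟩ | ⟨r', hr', rfl⟩
    · obtain ⟨q', ⟨q, hq, hq'⟩, ht'⟩ := ih
        {p' | ∃ s ∈ P, Step s a p'} {q' | ∃ s ∈ Q, Step s a q'} r (by
          rintro β Z ⟨t, ⟨s, hs, hst⟩, ht⟩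
          obtain ⟨q, hq, hβ⟩ := h (a :: β) Z ⟨s, hs, cons_mem_readyPairs.2 ⟨t, hst, ht⟩⟩
          obtain ⟨q', hq', htq⟩ := cons_mem_readyPairs.1 hβ
          exact ⟨q', ⟨q, hq, hq'⟩, htq⟩) ⟨p', ⟨p, hp, hp'⟩, ht⟩
      exact ⟨q, hq, cons_mem_readyPairs.2 ⟨_, .parLeft _ hq', ht'⟩⟩
    · obtain ⟨q, hq, ht'⟩ := ih P Q r' h ⟨p, hp, ht⟩
      exact ⟨q, hq, cons_mem_readyPairs.2 ⟨_, .parRight _ hr', ht'⟩⟩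

theorem failurePairs_par_mono (P Q : Set (Term A)) (r : Term A) (X : Set A) (α : List A)
    (h : ∀ β Y, (∃ p ∈ P, (β, Y) ∈ failurePairs p) → ∃ q ∈ Q, (β, Y) ∈ failurePairs q)
    (hP : ∃ p ∈ P, (α, X) ∈ failurePairs (par p r)) :
    ∃ q ∈ Q, (α, X) ∈ failurePairs (par q r) := by
  induction α generalizing P Q r with
  | nil =>
    obtain ⟨p, hp, hX⟩ := hP
    simp only [nil_mem_failurePairs, initials_par, Set.union_inter_distrib_right,
      Set.union_empty_iff] at hX
    obtain ⟨q, hq, hI⟩ := h [] X ⟨p, hp, nil_mem_failurePairs.2 hX.1⟩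
    refine ⟨q, hq, ?_⟩
    simp only [nil_mem_failurePairs, initials_par, Set.union_inter_distrib_right,
      Set.union_empty_iff] at hI ⊢
    exact ⟨hI, hX.2⟩
  | cons a α ih =>
    obtain ⟨p, hp, hX⟩ := hP
    obtain ⟨r', hr, ht⟩ := cons_mem_failurePairs.1 hX
    rcases step_par.1 hr with ⟨p', hp', rfl⟩ | ⟨r', hr', rfl⟩
    · obtain ⟨q', ⟨q, hq, hq'⟩, ht'⟩ := ih
        {p' | ∃ s ∈ P, Step s a p'} {q' | ∃ s ∈ Q, Step s a q'} r (by
          rintro β Z ⟨t, ⟨s, hs, hst⟩, ht⟩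
          obtain ⟨q, hq, hβ⟩ := h (a :: β) Z ⟨s, hs, cons_mem_failurePairs.2 ⟨t, hst, ht⟩⟩
          obtain ⟨q', hq', htq⟩ := cons_mem_failurePairs.1 hβ
          exact ⟨q', ⟨q, hq, hq'⟩, htq⟩) ⟨p', ⟨p, hp, hp'⟩, ht⟩
      exact ⟨q, hq, cons_mem_failurePairs.2 ⟨_, .parLeft _ hq', ht'⟩⟩
    · obtain ⟨q, hq, ht'⟩ := ih P Q r' h ⟨p, hp, ht⟩
      exact ⟨q, hq, cons_mem_failurePairs.2 ⟨_, .parRight _ hr', ht'⟩⟩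

theorem SemEquiv.par_right {X : Sem} {p q : Term A} (r : Term A) (h : SemEquiv X p q) :
    SemEquiv X (par p r) (par q r) := by
  cases X with
  | RT =>
    have key : ∀ p q : Term A, readyTraces p = readyTraces q →
        ∀ X l, IsReadyTrace (Term.par p r) X l → IsReadyTrace (Term.par q r) X l :=
      fun p q h X l ht => by
        simpa using isReadyTrace_par_mono {p} {q} r X l (by simp [readyTraces_iff h]) ⟨p, rfl, ht⟩
    exact readyTraces_ext fun X l => ⟨key p q h X l, key q p h.symm X l⟩
  | FT =>
    have key : ∀ p q : Term A, failureTraces p = failureTraces q →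
        ∀ X l, IsFailureTrace (Term.par p r) X l → IsFailureTrace (Term.par q r) X l :=
      fun p q h X l ht => by
        simpa using isFailureTrace_par_mono {p} {q} r X l (by simp [failureTraces_iff h])
          ⟨p, rfl, ht⟩
    exact failureTraces_ext fun X l => ⟨key p q h X l, key q p h.symm X l⟩
  | R =>
    have key : ∀ p q : Term A, readyPairs p = readyPairs q →
        ∀ α X, (α, X) ∈ readyPairs (Term.par p r) → (α, X) ∈ readyPairs (Term.par q r) :=
      fun p q h α X ht => by
        simpa using readyPairs_par_mono {p} {q} r X α (by simp [h]) ⟨p, rfl, ht⟩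
    exact readyPairs_ext fun α X => ⟨key p q h α X, key q p h.symm α X⟩
  | F =>
    have key : ∀ p q : Term A, failurePairs p = failurePairs q →
        ∀ α X, (α, X) ∈ failurePairs (Term.par p r) → (α, X) ∈ failurePairs (Term.par q r) :=
      fun p q h α X ht => by
        simpa using failurePairs_par_mono {p} {q} r X α (by simp [h]) ⟨p, rfl, ht⟩
    exact failurePairs_ext fun α X => ⟨key p q h α X, key q p h.symm α X⟩

theorem readyTraces_par_comm (p q : Term A) :
    readyTraces (par p q) = readyTraces (par q p) := by
  have h₁ : ∀ s t c s', (∃ x y : Term A, s = par x y ∧ t = par y x) → Step s c s' →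
      ∃ t', Step t c t' ∧ ∃ x y : Term A, s' = par x y ∧ t' = par y x := by
    rintro _ _ c s' ⟨x, y, rfl, rfl⟩ hs
    rcases step_par.1 hs with ⟨x', hx, rfl⟩ | ⟨y', hy, rfl⟩
    · exact ⟨_, .parRight _ hx, _, _, rfl, rfl⟩
    · exact ⟨_, .parLeft _ hy, _, _, rfl, rfl⟩
  refine readyTraces_eq_of_bisim (fun s t => ∃ x y : Term A, s = par x y ∧ t = par y x) h₁ ?_
    ⟨p, q, rfl, rfl⟩
  rintro _ _ c t' ⟨x, y, rfl, rfl⟩ ht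
  obtain ⟨s', hs, x', y', rfl, rfl⟩ := h₁ _ _ c t' ⟨y, x, rfl, rfl⟩ ht
  exact ⟨_, hs, _, _, rfl, rfl⟩

theorem SemEquiv.par {X : Sem} {p q p' q' : Term A} (h : SemEquiv X p q)
    (h' : SemEquiv X p' q') : SemEquiv X (par p p') (par q q') :=
  (h.par_right p').trans <|
    (semEquiv_of_readyTraces (readyTraces_par_comm _ _) X).trans <|
      (h'.par_right q).trans (semEquiv_of_readyTraces (readyTraces_par_comm _ _) X)

end Congruence

/-- An axiom system whose instances are valid derives only valid equations. -/
theorem Derives.semEquiv {E : Set (Equation A)} {X : Sem}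
    (hE : ∀ e ∈ E, ∀ σ : ℕ → Term A, SemEquiv X (e.1.subst σ) (e.2.subst σ))
    {t v : Term A} (h : Derives E t v) : SemEquiv X t v := by
  -- Quantifying over all substitutions makes the substitution rule part of the induction.
  suffices ∀ σ : ℕ → Term A, SemEquiv X (t.subst σ) (v.subst σ) by
    simpa [subst_var] using this Term.var
  induction h with
  | ax h => exact hE _ h
  | refl t => exact fun σ => .refl X _
  | symm _ ih => exact fun σ => (ih σ).symm
  | trans _ _ ih ih' => exact fun σ => (ih σ).trans (ih' σ)
  | subst τ _ ih => exact fun σ => by simpa [subst_subst] using ih fun x => (τ x).subst σ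
  | act a _ ih => exact fun σ => (ih σ).act a
  | alt _ _ ih ih' => exact fun σ => (ih σ).alt (ih' σ)
  | par _ _ ih ih' => exact fun σ => (ih σ).par (ih' σ)

/-! ### Soundness of the axioms -/

section Axioms

theorem readyTraces_par_nil (p : Term A) : readyTraces (par p nil) = readyTraces p := by
  refine readyTraces_eq_of_bisim (fun s t => s = par t nil) ?_ ?_ rfl
  · rintro _ t c s' rfl hs
    rcases step_par.1 hs with ⟨x', hx, rfl⟩ | ⟨y', hy, rfl⟩
    · exact ⟨_, hx, rfl⟩
    · simp at hy
  · rintro _ t c t' rfl ht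
    exact ⟨_, .parLeft _ ht, rfl⟩

/-- All three left operands have the same initials, and the choice between `x` and `y` is open only
while `z` moves alone; the induction follows those moves. -/
theorem isReadyTrace_fp (a : A) (x y w z : Term A) (X : Set A) (l : List (A × Set A)) :
    IsReadyTrace (par (alt (alt (act a x) (act a y)) w) z) X l ↔
      IsReadyTrace (par (alt (act a x) w) z) X l ∨
      IsReadyTrace (par (alt (act a y) w) z) X l := by
  induction l generalizing z X with
  | nil => simp [IsReadyTrace]
  | cons e l ih =>
    obtain ⟨c, Y⟩ := e
    simp only [IsReadyTrace, initials_par, initials_alt, initials_act, Set.union_self,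
      ← and_or_left]
    refine and_congr_right fun _ => ?_
    simp only [step_par, step_alt, step_act]
    constructor
    · rintro ⟨r, ⟨p', (⟨⟨h, rfl⟩ | ⟨h, rfl⟩⟩ | h), rfl⟩ | ⟨z', h, rfl⟩, ht⟩
      · exact .inl ⟨_, .inl ⟨_, .inl ⟨h, rfl⟩, rfl⟩, ht⟩
      · exact .inr ⟨_, .inl ⟨_, .inl ⟨h, rfl⟩, rfl⟩, ht⟩
      · exact .inl ⟨_, .inl ⟨_, .inr h, rfl⟩, ht⟩
      · exact ((ih z' Y).1 ht).imp (fun ht => ⟨_, .inr ⟨_, h, rfl⟩, ht⟩)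
          fun ht => ⟨_, .inr ⟨_, h, rfl⟩, ht⟩
    · rintro (⟨r, ⟨p', ⟨h, rfl⟩ | h, rfl⟩ | ⟨z', h, rfl⟩, ht⟩ |
        ⟨r, ⟨p', ⟨h, rfl⟩ | h, rfl⟩ | ⟨z', h, rfl⟩, ht⟩)
      · exact ⟨_, .inl ⟨_, .inl (.inl ⟨h, rfl⟩), rfl⟩, ht⟩
      · exact ⟨_, .inl ⟨_, .inr h, rfl⟩, ht⟩
      · exact ⟨_, .inr ⟨_, h, rfl⟩, (ih z' Y).2 (.inl ht)⟩
      · exact ⟨_, .inl ⟨_, .inl (.inr ⟨h, rfl⟩), rfl⟩, ht⟩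
      · exact ⟨_, .inl ⟨_, .inr h, rfl⟩, ht⟩
      · exact ⟨_, .inr ⟨_, h, rfl⟩, (ih z' Y).2 (.inr ht)⟩

theorem sound_axE1 (e : Equation A) (he : e ∈ axE1 A) (σ : ℕ → Term A) :
    readyTraces (e.1.subst σ) = readyTraces (e.2.subst σ) := by
  rcases he with (rfl | rfl | rfl | rfl) | (rfl | rfl)
  · exact readyTraces_eq_of_step (by simp [Term.subst])
  · exact readyTraces_eq_of_step (by simp [Term.subst, or_comm])
  · exact readyTraces_eq_of_step (by simp [Term.subst, or_assoc])
  · exact readyTraces_eq_of_step (by simp [Term.subst])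
  · exact readyTraces_par_nil _
  · exact readyTraces_par_comm _ _

theorem sound_axEL2 (e : Equation A) (he : e ∈ axEL2 A) (σ : ℕ → Term A) :
    readyTraces (e.1.subst σ) = readyTraces (e.2.subst σ) := by
  obtain ⟨k, m, a, b, -, -, rfl⟩ := he
  refine readyTraces_eq_of_step fun c r => ?_
  simp only [Term.subst, subst_sum, step_par, step_alt, step_sum, step_act]
  constructor
  · rintro (⟨_, ⟨i, h, rfl⟩, rfl⟩ | ⟨_, ⟨i, h, rfl⟩, rfl⟩)
    exacts [.inl ⟨i, h, rfl⟩, .inr ⟨i, h, rfl⟩]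
  · rintro (⟨i, h, rfl⟩ | ⟨i, h, rfl⟩)
    exacts [.inl ⟨_, ⟨i, h, rfl⟩, rfl⟩, .inr ⟨_, ⟨i, h, rfl⟩, rfl⟩]

theorem sound_axFP (e : Equation A) (he : e ∈ axFP A) (σ : ℕ → Term A) :
    readyTraces (e.1.subst σ) = readyTraces (e.2.subst σ) := by
  obtain ⟨a, rfl⟩ := he
  refine readyTraces_ext fun X l => ?_
  simp only [Term.subst]
  rw [isReadyTrace_alt (by simp), isReadyTrace_fp]

/-- The three sums under the prefix have the same initials, the bᵢ together with I(z), so selecting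
the x-family or the y-family at the step a loses no ready trace. -/
theorem sound_axRT [Fintype A] (e : Equation A) (he : e ∈ axRT A) (σ : ℕ → Term A) :
    readyTraces (e.1.subst σ) = readyTraces (e.2.subst σ) := by
  obtain ⟨a, b, rfl⟩ := he
  simp only [Term.subst, subst_sum]
  set z := σ 0
  have hI : ∀ t : ℕ → Term A, initials (sum fun i => act (b i) (t i)) = Set.range b := by
    intro t
    ext c
    simp [initials, step_sum, eq_comm]
  have hI' : ∀ t t' : ℕ → Term A,
      initials (sum fun i => alt (act (b i) (t i)) (act (b i) (t' i))) = Set.range b := by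
    intro t t'
    ext c
    simp [initials, step_sum, eq_comm, exists_or]
  refine readyTraces_ext fun X l => ?_
  rw [isReadyTrace_alt (by simp)]
  cases l with
  | nil => simp [IsReadyTrace]
  | cons e l =>
    obtain ⟨c, Y⟩ := e
    have := fun X l => isReadyTrace_of_step_iff
      (p := alt (sum fun i => alt (act (b i) (σ (2 * i + 1))) (act (b i) (σ (2 * i + 2)))) z)
      (t := fun k : Bool => cond k (alt (sum fun i => act (b i) (σ (2 * i + 1))) z)
        (alt (sum fun i => act (b i) (σ (2 * i + 2))) z))
      (fun c r => by
        simp only [step_alt, step_sum, Bool.exists_bool, cond_true, cond_false, exists_or]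
        tauto)
      (fun k => by
        have h₁ := hI fun i => σ (2 * i + 1)
        have h₂ := hI fun i => σ (2 * i + 2)
        have h₃ := hI' (fun i => σ (2 * i + 1)) fun i => σ (2 * i + 2)
        cases k <;> simp [h₁, h₂, h₃]) X l
    simp only [IsReadyTrace, initials_act, step_act, and_assoc, exists_and_left, exists_eq_left,
      this, Bool.exists_bool, cond_true, cond_false, ← and_or_left]
    rw [or_comm]

theorem isFailureTrace_of_alt {p q : Term A} {X : Set A} {l : List (A × Set A)}
    (h : IsFailureTrace (alt p q) X l) : IsFailureTrace p X l ∨ IsFailureTrace q X l :=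
  ((isFailureTrace_alt_iff X l).1 h).imp And.left And.right

theorem IsFailureTrace.mono {p q : Term A} {X : Set A} {l : List (A × Set A)}
    (h : IsFailureTrace p X l) (hs : ∀ c r, Step p c r → Step q c r)
    (hI : initials q ⊆ initials p) : IsFailureTrace q X l := by
  have hX : initials q ∩ X = ∅ :=
    Set.eq_empty_of_subset_empty (h.inter_eq ▸ Set.inter_subset_inter_left X hI)
  cases l with
  | nil => exact hX
  | cons x l => exact ⟨hX, h.2.imp fun r hr => ⟨hs _ _ hr.1, hr.2⟩⟩

theorem failureTraces_eq_of_derivatives {p q : Term A} (hI : initials p = initials q)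
    (h : ∀ c X l, (∃ r, Step p c r ∧ IsFailureTrace r X l) ↔
      ∃ r, Step q c r ∧ IsFailureTrace r X l) : failureTraces p = failureTraces q := by
  refine failureTraces_ext fun X l => ?_
  cases l with
  | nil => simp [IsFailureTrace, hI]
  | cons x l => simp only [IsFailureTrace, hI, h]

theorem readyPairs_eq_of_derivatives {p q : Term A} (hI : initials p = initials q)
    (h : ∀ c α X, (∃ r, Step p c r ∧ (α, X) ∈ readyPairs r) ↔
      ∃ r, Step q c r ∧ (α, X) ∈ readyPairs r) : readyPairs p = readyPairs q := by
  refine readyPairs_ext fun α X => ?_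
  cases α with
  | nil => simp [nil_mem_readyPairs, hI]
  | cons a α => simp only [cons_mem_readyPairs, h]

theorem failurePairs_eq_of_derivatives {p q : Term A} (hI : initials p = initials q)
    (h : ∀ c α X, (∃ r, Step p c r ∧ (α, X) ∈ failurePairs r) ↔
      ∃ r, Step q c r ∧ (α, X) ∈ failurePairs r) : failurePairs p = failurePairs q := by
  refine failurePairs_ext fun α X => ?_
  cases α with
  | nil => simp [nil_mem_failurePairs, hI]
  | cons a α => simp only [cons_mem_failurePairs, h]

/-- A sum refuses no more than either summand, so a failure trace of x + y is one of x or of y. -/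
theorem sound_axFT (e : Equation A) (he : e ∈ axFT A) (σ : ℕ → Term A) :
    failureTraces (e.1.subst σ) = failureTraces (e.2.subst σ) := by
  obtain ⟨a, rfl⟩ := he
  refine failureTraces_eq_of_derivatives (by simp [Term.subst]) fun c X l => ?_
  have := @isFailureTrace_of_alt _ (σ 0) (σ 1) X l
  simp only [Term.subst, step_alt, step_act, or_and_right, exists_or, and_assoc, exists_and_left,
    exists_eq_left]
  tauto

/-- Dropping by while bx remains leaves the initials unchanged and only removes transitions. -/
theorem sound_axRS (e : Equation A) (he : e ∈ axRS A) (σ : ℕ → Term A) :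
    failureTraces (e.1.subst σ) = failureTraces (e.2.subst σ) := by
  obtain ⟨a, b, rfl⟩ := he
  refine failureTraces_eq_of_derivatives (by simp [Term.subst]) fun c X l => ?_
  have : IsFailureTrace (alt (act b (σ 0)) (σ 2)) X l →
      IsFailureTrace (alt (alt (act b (σ 0)) (act b (σ 1))) (σ 2)) X l := fun h =>
    h.mono (fun c r => by simp only [step_alt]; tauto) (by simp)
  simp only [Term.subst, step_alt, step_act, or_and_right, exists_or, and_assoc, exists_and_left,
    exists_eq_left]
  tauto

/-- Adding by beside bx does not change the initials, and the new runs through y are already runs of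
the other summand. -/
theorem sound_axR (e : Equation A) (he : e ∈ axR A) (σ : ℕ → Term A) :
    readyPairs (e.1.subst σ) = readyPairs (e.2.subst σ) := by
  obtain ⟨a, b, rfl⟩ := he
  refine readyPairs_eq_of_derivatives (by simp [Term.subst]) fun c α X => ?_
  cases α with
  | nil =>
    simp [Term.subst, or_and_right, exists_or, and_assoc, nil_mem_readyPairs]
  | cons d α =>
    simp only [Term.subst, step_alt, step_act, or_and_right, exists_or, and_assoc,
      exists_and_left, exists_eq_left, cons_mem_readyPairs]
    grind

/-- What x + y refuses initially x refuses as well, and each of its nonempty runs is a run of x or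
of y + z. -/
theorem sound_axF (e : Equation A) (he : e ∈ axF A) (σ : ℕ → Term A) :
    failurePairs (e.1.subst σ) = failurePairs (e.2.subst σ) := by
  obtain ⟨a, rfl⟩ := he
  refine failurePairs_eq_of_derivatives (by simp [Term.subst]) fun c α X => ?_
  cases α with
  | nil =>
    simp only [Term.subst, step_alt, step_act, or_and_right, exists_or, and_assoc,
      exists_and_left, exists_eq_left, nil_mem_failurePairs, initials_alt,
      Set.union_inter_distrib_right, Set.union_empty_iff]
    tauto
  | cons d α =>
    simp only [Term.subst, step_alt, step_act, or_and_right, exists_or, and_assoc,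
      exists_and_left, exists_eq_left, cons_mem_failurePairs]
    grind

theorem semEquiv_of_mem_axSystem [Fintype A] (X : Sem) (e : Equation A) (he : e ∈ axSystem A X)
    (σ : ℕ → Term A) : SemEquiv X (e.1.subst σ) (e.2.subst σ) := by
  cases X with
  | RT =>
    rcases he with ((he | he) | he) | he
    exacts [sound_axE1 e he σ, sound_axRT e he σ, sound_axFP e he σ, sound_axEL2 e he σ]
  | FT =>
    rcases he with (((he | he) | he) | he) | he
    exacts [semEquiv_of_readyTraces (sound_axE1 e he σ) .FT, sound_axFT e he σ,
      sound_axRS e he σ, semEquiv_of_readyTraces (sound_axFP e he σ) .FT,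
      semEquiv_of_readyTraces (sound_axEL2 e he σ) .FT]
  | R =>
    rcases he with ((he | he) | he) | he
    exacts [semEquiv_of_readyTraces (sound_axE1 e he σ) .R, sound_axR e he σ,
      semEquiv_of_readyTraces (sound_axFP e he σ) .R,
      semEquiv_of_readyTraces (sound_axEL2 e he σ) .R]
  | F =>
    rcases he with (((he | he) | he) | he) | he
    exacts [semEquiv_of_readyTraces (sound_axE1 e he σ) .F, sound_axF e he σ,
      failurePairs_eq_of_readyPairs (sound_axR e he σ),
      semEquiv_of_readyTraces (sound_axFP e he σ) .F,
      semEquiv_of_readyTraces (sound_axEL2 e he σ) .F]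

end Axioms

/-! ### Finiteness of the axiom systems -/

section Finiteness

/-- Distinctness of the actions bounds both numbers of summands by |A|. -/
theorem finite_axEL2 (A : Type u) [Finite A] : (axEL2 A).Finite := by
  have := Fintype.ofFinite A
  refine Set.Finite.subset (s := ⋃ k ∈ Set.Iic (Fintype.card A), ⋃ m ∈ Set.Iic (Fintype.card A),
    Set.range fun ab : (Fin k → A) × (Fin m → A) =>
      (par (sum fun i => act (ab.1 i) (var (2 * i)))
             (sum fun j => act (ab.2 j) (var (2 * j + 1))),
         alt (sum fun i => act (ab.1 i)
                (par (var (2 * i)) (sum fun j => act (ab.2 j) (var (2 * j + 1)))))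
             (sum fun j => act (ab.2 j)
                (par (sum fun i => act (ab.1 i) (var (2 * i))) (var (2 * j + 1)))))) ?_ ?_
  · exact (Set.finite_Iic _).biUnion fun k _ => (Set.finite_Iic _).biUnion fun m _ =>
      Set.finite_range _
  · rintro _ ⟨k, m, a, b, ha, hb, rfl⟩
    have hk := Fintype.card_le_of_injective a ha
    have hm := Fintype.card_le_of_injective b hb
    rw [Fintype.card_fin] at hk hm
    exact Set.mem_biUnion hk (Set.mem_biUnion hm ⟨(a, b), rfl⟩)

theorem finite_range_setOf {ι : Type*} [Finite ι] (f : ι → Equation A) :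
    {e | ∃ i, e = f i}.Finite :=
  (Set.finite_range f).subset fun _ ⟨i, hi⟩ => ⟨i, hi.symm⟩

theorem finite_range_setOf₂ {ι κ : Type*} [Finite ι] [Finite κ] (f : ι → κ → Equation A) :
    {e | ∃ i j, e = f i j}.Finite :=
  (Set.finite_range fun x : ι × κ => f x.1 x.2).subset fun _ ⟨i, j, hi⟩ => ⟨(i, j), hi.symm⟩

theorem finite_axSystem (A : Type u) [Fintype A] (X : Sem) : (axSystem A X).Finite := by
  have h₁ : (axE1 A).Finite := (Set.toFinite {_, _, _, _}).union (Set.toFinite {_, _})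
  have h₂ := finite_axEL2 A
  have h₃ : (axFP A).Finite := finite_range_setOf _
  cases X with
  | RT => exact ((h₁.union (finite_range_setOf₂ _)).union h₃).union h₂
  | FT =>
    exact (((h₁.union (finite_range_setOf _)).union (finite_range_setOf₂ _)).union h₃).union h₂
  | R => exact ((h₁.union (finite_range_setOf₂ _)).union h₃).union h₂
  | F =>
    exact (((h₁.union (finite_range_setOf _)).union (finite_range_setOf₂ _)).union h₃).union h₂

end Finiteness

/-! ### The semilattice of terms modulo provable equality -/

section Quotient

/-- Derivable equality. -/
def derivSetoid (E : Set (Equation A)) : Setoid (Term A) :=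
  ⟨Derives E, .refl, .symm, .trans⟩

/-- Terms modulo derivable equality. -/
def Cls (E : Set (Equation A)) : Type u := Quotient (derivSetoid E)

/-- The class of a term. -/
def cls (E : Set (Equation A)) (t : Term A) : Cls E := Quotient.mk _ t

variable {E : Set (Equation A)}

theorem cls_eq_iff {t v : Term A} : cls E t = cls E v ↔ Derives E t v := Quotient.eq

theorem exists_cls_eq (z : Cls E) : ∃ t, cls E t = z := Quotient.exists_rep z

/-- Prefixing of classes. -/
def pre (a : A) : Cls E → Cls E := Quotient.map (act a) fun _ _ h => h.act a

/-- Parallel composition of classes. -/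
def cpar : Cls E → Cls E → Cls E := Quotient.map₂ par fun _ _ h _ _ h' => h.par h'

theorem cls_act (a : A) (t : Term A) : cls E (act a t) = pre a (cls E t) := rfl

theorem cls_par (t v : Term A) : cls E (par t v) = cpar (cls E t) (cls E v) := rfl

/-- Addition of classes. -/
def csup : Cls E → Cls E → Cls E := Quotient.map₂ alt fun _ _ h _ _ h' => h.alt h'

theorem cls_subst_eq {e : Equation A} (he : e ∈ E) (σ : ℕ → Term A) :
    cls E (e.1.subst σ) = cls E (e.2.subst σ) :=
  cls_eq_iff.2 (.subst σ (.ax he))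

/-- The value of a term under an assignment of classes to the variables. -/
noncomputable def ev (ρ : ℕ → Cls E) (t : Term A) : Cls E :=
  cls E (t.subst fun n => (ρ n).out)

theorem ev_eq {t v : Term A} (h : (t, v) ∈ E) (ρ : ℕ → Cls E) : ev ρ t = ev ρ v :=
  cls_subst_eq h _

@[simp] theorem ev_var (ρ : ℕ → Cls E) (n : ℕ) : ev ρ (var n) = ρ n := Quotient.out_eq _

@[simp] theorem ev_act (ρ : ℕ → Cls E) (a : A) (t : Term A) :
    ev ρ (act a t) = pre a (ev ρ t) := rfl

@[simp] theorem ev_par (ρ : ℕ → Cls E) (t v : Term A) :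
    ev ρ (par t v) = cpar (ev ρ t) (ev ρ v) := rfl

variable [hE : Fact (axE0 A ⊆ E)]

theorem csup_comm (x y : Cls E) : csup x y = csup y x := by
  obtain ⟨s, rfl⟩ := exists_cls_eq x
  obtain ⟨t, rfl⟩ := exists_cls_eq y
  exact cls_subst_eq (hE.out (.inr (.inl rfl))) fun n => if n = 0 then s else t

theorem csup_assoc (x y z : Cls E) : csup (csup x y) z = csup x (csup y z) := by
  obtain ⟨s, rfl⟩ := exists_cls_eq x
  obtain ⟨t, rfl⟩ := exists_cls_eq y
  obtain ⟨v, rfl⟩ := exists_cls_eq z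
  exact cls_subst_eq (hE.out (.inr (.inr (.inl rfl))))
    fun n => if n = 0 then s else if n = 1 then t else v

theorem csup_idem (x : Cls E) : csup x x = x := by
  obtain ⟨s, rfl⟩ := exists_cls_eq x
  exact cls_subst_eq (hE.out (.inr (.inr (.inr rfl)))) fun _ => s

/-- In the resulting order x ≤ y says that x + y ≈ y is derivable, so provable equality can be shown
as two absorptions. -/
instance : SemilatticeSup (Cls E) := @SemilatticeSup.mk' _ ⟨csup⟩ csup_comm csup_assoc csup_idem

instance : OrderBot (Cls E) where
  bot := cls E nil
  bot_le x := by
    obtain ⟨s, rfl⟩ := exists_cls_eq x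
    have : cls E s ⊔ cls E nil = cls E s := cls_subst_eq (hE.out (.inl rfl)) fun _ => s
    exact this ▸ le_sup_right

theorem cls_alt (t v : Term A) : cls E (alt t v) = cls E t ⊔ cls E v := rfl

theorem cls_nil : cls E nil = ⊥ := rfl

theorem cls_listSum (l : List (Term A)) : cls E (listSum l) = (l.map (cls E)).foldr (· ⊔ ·) ⊥ := by
  induction l with
  | nil => rfl
  | cons t l ih =>
    cases l with
    | nil => exact (sup_bot_eq _).symm
    | cons v l => rw [List.map_cons, List.foldr_cons, ← ih]; rfl

theorem cls_sum {k : ℕ} (t : Fin k → Term A) :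
    cls E (sum t) = Finset.univ.sup fun i => cls E (t i) := by
  rw [sum, cls_listSum, List.map_ofFn]
  refine eq_of_forall_ge_iff fun c => ?_
  have : ∀ l : List (Cls E), l.foldr (· ⊔ ·) ⊥ ≤ c ↔ ∀ x ∈ l, x ≤ c := fun l => by
    induction l with
    | nil => simp
    | cons x l ih => simp [ih]
  simp [this, List.mem_ofFn]

@[simp] theorem ev_alt (ρ : ℕ → Cls E) (t v : Term A) : ev ρ (alt t v) = ev ρ t ⊔ ev ρ v := rfl

@[simp] theorem ev_sum (ρ : ℕ → Cls E) {k : ℕ} (t : Fin k → Term A) :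
    ev ρ (sum t) = Finset.univ.sup fun i => ev ρ (t i) := by
  rw [ev, subst_sum, cls_sum]
  rfl

end Quotient

/-! ### FP and the expansion law in the quotient -/

section Laws

variable {E : Set (Equation A)}

theorem cpar_comm (h : axE1 A ⊆ E) (x y : Cls E) : cpar x y = cpar y x := by
  simpa using ev_eq (h (.inr (.inr rfl))) fun n => if n = 0 then x else y

variable [hE : Fact (axE0 A ⊆ E)]

theorem cpar_fp (h : axFP A ⊆ E) (a : A) (x y w z : Cls E) :
    cpar (pre a x ⊔ pre a y ⊔ w) z = cpar (pre a x ⊔ w) z ⊔ cpar (pre a y ⊔ w) z := by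
  simpa using ev_eq (h ⟨a, rfl⟩) fun n =>
    if n = 0 then x else if n = 1 then y else if n = 2 then w else z

theorem sup_equivFin {α ι : Type*} [SemilatticeSup α] [OrderBot α] (S : Finset ι) (g : ι → α) :
    (Finset.univ.sup fun i => g (S.equivFin.symm i)) = S.sup g :=
  eq_of_forall_ge_iff fun c => by
    simp only [Finset.sup_le_iff, Finset.mem_univ, true_imp_iff]
    exact ⟨fun h s hs => by simpa using h (S.equivFin ⟨s, hs⟩),
      fun h i => h _ (S.equivFin.symm i).2⟩

theorem cpar_expansion (h : axEL2 A ⊆ E) {ι : Type*} (S T : Finset ι) (a : ι → A)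
    (x : ι → Cls E) (hS : Set.InjOn a S) (hT : Set.InjOn a T) :
    cpar (S.sup fun s => pre (a s) (x s)) (T.sup fun s => pre (a s) (x s)) =
      (S.sup fun s => pre (a s) (cpar (x s) (T.sup fun s => pre (a s) (x s)))) ⊔
      T.sup fun t => pre (a t) (cpar (S.sup fun s => pre (a s) (x s)) (x t)) := by
  -- Variable 2i receives the body of the i-th element of `S`, variable 2j + 1 that of the j-th
  -- element of `T`; the default ⊥ only reaches variables that do not occur.
  have key := ev_eq (h ⟨_, _, fun i => a (S.equivFin.symm i), fun i => a (T.equivFin.symm i),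
    fun i j hij => S.equivFin.symm.injective (Subtype.ext (hS (by simp) (by simp) hij)),
    fun i j hij => T.equivFin.symm.injective (Subtype.ext (hT (by simp) (by simp) hij)), rfl⟩)
    fun n => if n % 2 = 0 then
        if h : n / 2 < S.card then x (S.equivFin.symm ⟨n / 2, h⟩) else ⊥
      else if h : n / 2 < T.card then x (T.equivFin.symm ⟨n / 2, h⟩) else ⊥
  have h₁ : ∀ i : ℕ, (2 * i + 1) % 2 = 1 := by omega
  have h₂ : ∀ i : ℕ, (2 * i + 1) / 2 = i := by omega
  simp only [ev_par, ev_alt, ev_sum, ev_act, ev_var, h₁, h₂, Nat.mul_mod_right,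
    Nat.mul_div_cancel_left _ two_pos, Fin.is_lt, dite_true, if_true, one_ne_zero, if_false,
    Fin.eta] at key
  rw [sup_equivFin S fun s => pre (a s) (x s), sup_equivFin T fun s => pre (a s) (x s),
    sup_equivFin S fun s => pre (a s) (cpar (x s) _),
    sup_equivFin T fun s => pre (a s) (cpar _ (x s))] at key
  exact key

end Laws

/-! ### Elimination of parallel composition -/

section Elimination

/-- Closed terms without parallel composition. -/
inductive Basic : Term A → Prop
  | nil : Basic nil
  | act (a : A) {t : Term A} (h : Basic t) : Basic (act a t)
  | alt {t v : Term A} (h : Basic t) (h' : Basic v) : Basic (alt t v)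

/-- The number of prefixes in a term. -/
def weight : Term A → ℕ
  | nil => 0
  | var _ => 0
  | act _ t => weight t + 1
  | alt t v => weight t + weight v
  | par t v => weight t + weight v

/-- The number of prefixes in a finite family of prefixed terms. -/
def mass (S : Finset (A × Term A)) : ℕ := ∑ s ∈ S, (weight s.2 + 1)

variable {E : Set (Equation A)} [hE : Fact (axE0 A ⊆ E)]

variable (E) in
/-- The class of the sum of a finite family of prefixed terms. -/
def val (S : Finset (A × Term A)) : Cls E := S.sup fun s => pre s.1 (cls E s.2)

theorem mass_erase_lt [DecidableEq (A × Term A)] {S : Finset (A × Term A)} {s : A × Term A}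
    (hs : s ∈ S) : mass (S.erase s) < mass S :=
  Finset.sum_erase_lt_of_pos hs (Nat.succ_pos _)

theorem weight_lt_mass {S : Finset (A × Term A)} {s : A × Term A} (hs : s ∈ S) :
    weight s.2 < mass S :=
  Finset.single_le_sum (f := fun s : A × Term A => weight s.2 + 1) (fun _ _ => Nat.zero_le _) hs

/-- Bodies of summands are themselves rewritten as families during the elimination; the bound on
`mass` keeps that recursion decreasing. -/
theorem Basic.exists_summands {t : Term A} (ht : Basic t) :
    ∃ S : Finset (A × Term A), (∀ s ∈ S, Basic s.2) ∧ mass S ≤ weight t ∧ val E S = cls E t ∧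
      Prod.fst '' (S : Set (A × Term A)) = initials t := by
  classical
  induction ht with
  | nil => exact ⟨∅, by simp, by simp [mass], rfl, by simp [initials]⟩
  | @act a t ht ih => exact ⟨{(a, t)}, by simpa, by simp [mass, weight], by simp [val, cls_act],
    by simp⟩
  | alt h h' ih ih' =>
    obtain ⟨S, hS, hm, hv, hi⟩ := ih
    obtain ⟨S', hS', hm', hv', hi'⟩ := ih'
    refine ⟨S ∪ S', fun s hs => (Finset.mem_union.1 hs).elim (hS s) (hS' s), ?_, ?_,
      by rw [Finset.coe_union, Set.image_union, hi, hi', initials_alt]⟩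
    · have := Finset.sum_union_inter (s₁ := S) (s₂ := S') (f := fun s => weight s.2 + 1)
      simp only [mass, weight] at *
      omega
    · rw [cls_alt, ← hv, ← hv', val, Finset.sup_union]; rfl

theorem sup_eq_of_mem [DecidableEq (A × Term A)] {S : Finset (A × Term A)} {s : A × Term A}
    (hs : s ∈ S) : val E S = pre s.1 (cls E s.2) ⊔ val E (S.erase s) := by
  conv_lhs => rw [← Finset.insert_erase hs]
  rw [val, Finset.sup_insert]; rfl

/-- This is FP with the bodies of `s` and `t` for x and y, and the rest of `S` for w. -/
theorem cpar_val_split (h : axFP A ⊆ E) [DecidableEq (A × Term A)] {S : Finset (A × Term A)}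
    {s t : A × Term A} (hs : s ∈ S) (ht : t ∈ S) (hst : s ≠ t) (h1 : s.1 = t.1) (z : Cls E) :
    cpar (val E S) z = cpar (val E (S.erase t)) z ⊔ cpar (val E (S.erase s)) z := by
  have hs' : s ∈ S.erase t := Finset.mem_erase.2 ⟨hst, hs⟩
  have ht' : t ∈ S.erase s := Finset.mem_erase.2 ⟨hst.symm, ht⟩
  rw [sup_eq_of_mem hs, sup_eq_of_mem hs', sup_eq_of_mem ht', Finset.erase_right_comm,
    ← sup_assoc, h1, cpar_fp h]

theorem exists_basic_cpar_val (h₁ : axE1 A ⊆ E) (h₂ : axFP A ⊆ E) (h₃ : axEL2 A ⊆ E)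
    (S T : Finset (A × Term A)) (hS : ∀ s ∈ S, Basic s.2) (hT : ∀ s ∈ T, Basic s.2) :
    ∃ r, Basic r ∧ cls E r = cpar (val E S) (val E T) := by
  classical
  -- FP deletes a summand, and EL2 replaces an operand by the body of one of its summands; both
  -- lower the total mass.
  induction hn : mass S + mass T using Nat.strong_induction_on generalizing S T with
  | _ n ih =>
  subst hn
  have split : ∀ x y : Cls E, (∃ r, Basic r ∧ cls E r = x) → (∃ r, Basic r ∧ cls E r = y) →
      ∃ r, Basic r ∧ cls E r = x ⊔ y := by
    rintro _ _ ⟨r, hr, rfl⟩ ⟨r', hr', rfl⟩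
    exact ⟨_, hr.alt hr', rfl⟩
  have supB : ∀ (S : Finset (A × Term A)) (x : A × Term A → Cls E),
      (∀ s ∈ S, ∃ r, Basic r ∧ cls E r = x s) →
      ∃ r, Basic r ∧ cls E r = S.sup fun s => pre s.1 (x s) := by
    intro S x hx
    refine Finset.sup_induction (p := fun z => ∃ r, Basic r ∧ cls E r = z) ⟨_, .nil, rfl⟩
      (fun x hx y hy => split x y hx hy) fun s hs => ?_
    obtain ⟨r, hr, h⟩ := hx s hs
    exact ⟨_, hr.act s.1, by rw [cls_act, h]⟩
  have hsub : ∀ S : Finset (A × Term A), (∀ s ∈ S, Basic s.2) → ∀ t, ∀ s ∈ S.erase t, Basic s.2 :=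
    fun S hS t s hs => hS s (Finset.mem_of_mem_erase hs)
  by_cases hSi : Set.InjOn Prod.fst (S : Set (A × Term A))
  · by_cases hTi : Set.InjOn Prod.fst (T : Set (A × Term A))
    · rw [val, val, cpar_expansion h₃ S T Prod.fst _ hSi hTi]
      refine split _ _ (supB S _ fun s hs => ?_) (supB T _ fun t ht => ?_)
      · obtain ⟨S', hS', hm, hv, -⟩ := (hS s hs).exists_summands (E := E)
        have := weight_lt_mass hs
        rw [← hv]
        exact ih _ (by omega) S' T hS' hT rfl
      · obtain ⟨T', hT', hm, hv, -⟩ := (hT t ht).exists_summands (E := E)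
        have := weight_lt_mass ht
        rw [← hv]
        exact ih _ (by omega) S T' hS hT' rfl
    · simp only [Set.InjOn, not_forall] at hTi
      obtain ⟨s, hs, t, ht, h1, hst⟩ := hTi
      rw [cpar_comm h₁, cpar_val_split h₂ hs ht hst h1, cpar_comm h₁ _ (val E S),
        cpar_comm h₁ _ (val E S)]
      have hs' := mass_erase_lt hs
      have ht' := mass_erase_lt ht
      exact split _ _ (ih _ (by omega) S (T.erase t) hS (hsub T hT t) rfl)
        (ih _ (by omega) S (T.erase s) hS (hsub T hT s) rfl)
  · simp only [Set.InjOn, not_forall] at hSi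
    obtain ⟨s, hs, t, ht, h1, hst⟩ := hSi
    rw [cpar_val_split h₂ hs ht hst h1]
    have hs' := mass_erase_lt hs
    have ht' := mass_erase_lt ht
    exact split _ _ (ih _ (by omega) (S.erase t) T (hsub S hS t) hT rfl)
      (ih _ (by omega) (S.erase s) T (hsub S hS s) hT rfl)

/-- Parallel composition can be eliminated from closed terms. -/
theorem exists_basic (h₁ : axE1 A ⊆ E) (h₂ : axFP A ⊆ E) (h₃ : axEL2 A ⊆ E) (p : Term A)
    (hp : p.Closed) : ∃ r, Basic r ∧ cls E r = cls E p := by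
  induction p with
  | nil => exact ⟨_, .nil, rfl⟩
  | var x => exact absurd hp (Set.singleton_ne_empty x)
  | act a t ih =>
    obtain ⟨r, hr, h⟩ := ih hp
    exact ⟨_, hr.act a, by rw [cls_act, cls_act, h]⟩
  | alt t v ih ih' =>
    obtain ⟨r, hr, h⟩ := ih (Set.union_empty_iff.1 hp).1
    obtain ⟨r', hr', h'⟩ := ih' (Set.union_empty_iff.1 hp).2
    exact ⟨_, hr.alt hr', by rw [cls_alt, cls_alt, h, h']⟩
  | par t v ih ih' =>
    obtain ⟨r, hr, h⟩ := ih (Set.union_empty_iff.1 hp).1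
    obtain ⟨r', hr', h'⟩ := ih' (Set.union_empty_iff.1 hp).2
    obtain ⟨S, hS, -, hv, -⟩ := hr.exists_summands (E := E)
    obtain ⟨T, hT, -, hv', -⟩ := hr'.exists_summands (E := E)
    rw [cls_par, ← h, ← h', ← hv, ← hv']
    exact exists_basic_cpar_val h₁ h₂ h₃ S T hS hT

end Elimination

/-! ### Terms without parallel composition: derivatives, depth, absorption -/

section BasicTerms

/-- The height of a term without parallel composition. -/
def depth : Term A → ℕ
  | nil => 0
  | var _ => 0
  | act _ t => depth t + 1
  | alt t v => max (depth t) (depth v)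
  | par _ _ => 0

theorem Basic.step {p r : Term A} {c : A} (hp : Basic p) (h : Step p c r) :
    Basic r ∧ depth r < depth p := by
  induction hp with
  | nil => simp at h
  | act a ht =>
    obtain ⟨rfl, rfl⟩ := step_act.1 h
    exact ⟨ht, Nat.lt_succ_self _⟩
  | alt _ _ ih ih' =>
    rcases step_alt.1 h with h | h
    · exact ⟨(ih h).1, lt_max_of_lt_left (ih h).2⟩
    · exact ⟨(ih' h).1, lt_max_of_lt_right (ih' h).2⟩

theorem Basic.finite_step {p : Term A} (hp : Basic p) :
    {x : A × Term A | Step p x.1 x.2}.Finite := by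
  induction hp with
  | nil => simp
  | @act a t ht =>
    exact (Set.finite_singleton (a, t)).subset fun x hx => Prod.ext_iff.2 (step_act.1 hx)
  | alt _ _ ih ih' => exact (ih.union ih').subset fun x hx => step_alt.1 hx

theorem Basic.listSum {l : List (Term A)} (h : ∀ t ∈ l, Basic t) : Basic (Term.listSum l) := by
  induction l with
  | nil => exact .nil
  | cons t l ih =>
    cases l with
    | nil => exact h t (by simp)
    | cons v l => exact (h t (by simp)).alt (ih fun t ht => h t (List.mem_cons_of_mem _ ht))

theorem depth_listSum_lt {l : List (Term A)} {n : ℕ} (hn : 0 < n) (h : ∀ t ∈ l, depth t < n) :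
    depth (Term.listSum l) < n := by
  induction l with
  | nil => exact hn
  | cons t l ih =>
    cases l with
    | nil => exact h t (by simp)
    | cons v l => exact max_lt (h t (by simp)) (ih fun t ht => h t (List.mem_cons_of_mem _ ht))

theorem exists_list_of_finite {α : Type*} {s : Set α} (hs : s.Finite) :
    ∃ l : List α, ∀ t, t ∈ l ↔ t ∈ s :=
  ⟨hs.toFinset.toList, by simp⟩

theorem Basic.exists_derivatives {p : Term A} (hp : Basic p) (a : A) (K : Term A → Prop) :
    ∃ l : List (Term A), ∀ t, t ∈ l ↔ Step p a t ∧ K t :=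
  exists_list_of_finite <| (hp.finite_step.image Prod.snd).subset fun t ht => ⟨(a, t), ht.1, rfl⟩

theorem Basic.exists_second_summands {p : Term A} (hp : Basic p) (a : A) (B : Set A) :
    ∃ l : List (Term A), ∀ t, t ∈ l ↔
      ∃ b ∈ B, ∃ p' r, Step p a p' ∧ Step p' b r ∧ t = Term.act b r := by
  refine exists_list_of_finite ((hp.finite_step.biUnion
    (t := fun x => (fun y : A × Term A => Term.act y.1 y.2) ''
      {y | Step p x.1 x.2 ∧ Step x.2 y.1 y.2})
    fun x hx => Set.Finite.image _ ?_).subset ?_)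
  · exact (hp.step hx).1.finite_step.subset fun y hy => hy.2
  · rintro _ ⟨b, -, p', r, h, h', rfl⟩
    exact Set.mem_biUnion (x := (a, p')) h ⟨(b, r), ⟨h, h'⟩, rfl⟩

end BasicTerms

section BasicClasses

variable {E : Set (Equation A)} [hE : Fact (axE0 A ⊆ E)]

theorem Basic.pre_le {p r : Term A} {c : A} (hp : Basic p) (h : Step p c r) :
    pre c (cls E r) ≤ cls E p := by
  induction hp with
  | nil => simp at h
  | act a ht =>
    obtain ⟨rfl, rfl⟩ := step_act.1 h
    exact le_rfl
  | alt _ _ ih ih' =>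
    rcases step_alt.1 h with h | h
    · exact (ih h).trans (cls_alt (E := E) _ _ ▸ le_sup_left)
    · exact (ih' h).trans (cls_alt (E := E) _ _ ▸ le_sup_right)

theorem Basic.cls_le {p : Term A} {z : Cls E} (hp : Basic p)
    (h : ∀ c r, Step p c r → pre c (cls E r) ≤ z) : cls E p ≤ z := by
  induction hp with
  | nil => exact bot_le
  | act a ht => exact h _ _ (.act _ _)
  | alt _ _ ih ih' =>
    exact sup_le (ih fun c r hr => h c r (.altLeft _ hr)) (ih' fun c r hr => h c r (.altRight _ hr))

theorem cls_listSum_cons (t : Term A) (l : List (Term A)) :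
    cls E (listSum (t :: l)) = cls E t ⊔ cls E (listSum l) := by
  simp [cls_listSum]

theorem cls_le_listSum {t : Term A} {l : List (Term A)} (h : t ∈ l) :
    cls E t ≤ cls E (listSum l) := by
  induction l with
  | nil => simp at h
  | cons v l ih =>
    rw [cls_listSum_cons]
    rcases List.mem_cons.1 h with rfl | h
    exacts [le_sup_left, le_sup_of_le_right (ih h)]

/-- A summand can be enlarged by a list of terms if it can be enlarged by each of them. -/
theorem pre_sup_listSum_le (good : Term A → Prop) {a : A} {z : Cls E} {l : List (Term A)}
    (h : ∀ r, good r → pre a (cls E r) ≤ z → ∀ t ∈ l,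
      good (alt r t) ∧ pre a (cls E r ⊔ cls E t) ≤ z)
    {p : Term A} (hp : good p) (hz : pre a (cls E p) ≤ z) :
    pre a (cls E p ⊔ cls E (listSum l)) ≤ z := by
  induction l generalizing p with
  | nil => simpa [listSum, cls_nil] using hz
  | cons t l ih =>
    obtain ⟨h₁, h₂⟩ := h p hp hz t (by simp)
    rw [cls_listSum_cons, ← sup_assoc]
    exact ih (fun r hr hz t ht => h r hr hz t (List.mem_cons_of_mem _ ht)) h₁ h₂

/-- The law `a(bx + z) ≤ a(bx + by + z)`. -/
def SaturationLaw (E : Set (Equation A)) [Fact (axE0 A ⊆ E)] : Prop :=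
  ∀ (a b : A) (x y z : Cls E), pre a (pre b x ⊔ z) ≤ pre a (pre b x ⊔ pre b y ⊔ z)

/-- Each summand by of `q` meets a summand bx of `p`, so the law with z = `p` adds it under the
prefix; the summands are added one after another. -/
theorem SaturationLaw.pre_le_sup (h : SaturationLaw E) {p q : Term A} (hp : Basic p)
    (hq : Basic q) (hI : initials q ⊆ initials p) (a : A) :
    pre a (cls E p) ≤ pre a (cls E p ⊔ cls E q) := by
  induction hq generalizing p with
  | nil => simp [cls_nil]
  | @act b y hy =>
    obtain ⟨x, hx⟩ := hI (show b ∈ initials (act b y) by simp)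
    have hle : pre b (cls E x) ≤ cls E p := hp.pre_le hx
    have := h a b (cls E x) (cls E y) (cls E p)
    rwa [sup_right_comm, sup_eq_right.2 hle] at this
  | @alt q₁ q₂ h₁ h₂ ih₁ ih₂ =>
    rw [initials_alt, Set.union_subset_iff] at hI
    rw [cls_alt, ← sup_assoc]
    exact (ih₁ hp hI.1).trans (ih₂ (hp.alt h₁) (hI.2.trans (by simp)))

theorem SaturationLaw.pre_le (h : SaturationLaw E) {p q : Term A} (hp : Basic p)
    (hq : Basic q) (hI : initials q ⊆ initials p) (hle : cls E p ≤ cls E q) (a : A) :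
    pre a (cls E p) ≤ pre a (cls E q) := by
  simpa [sup_eq_right.2 hle] using h.pre_le_sup hp hq hI a

/-- Related terms are derivably equal if the summands of one of them are absorbed by the other
up to related terms of smaller depth. -/
theorem cls_eq_of_absorption (R : Term A → Term A → Prop) (hR : ∀ p q, R p q → R q p)
    (h : ∀ p q, Basic p → Basic q → R p q → ∀ a q', Step q a q' →
      ∃ P Q, Basic P ∧ Basic Q ∧ depth P < depth p ∧ depth Q < depth q ∧ R P Q ∧
        pre a (cls E q') ≤ pre a (cls E Q) ∧ pre a (cls E P) ≤ cls E p)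
    {p q : Term A} (hp : Basic p) (hq : Basic q) (hpq : R p q) : cls E p = cls E q := by
  induction hn : depth p + depth q using Nat.strong_induction_on generalizing p q with
  | _ n ih =>
  subst hn
  -- Stated for a general pair of the same total depth, so that it also applies with `p` and `q`
  -- exchanged.
  have key : ∀ s t, Basic s → Basic t → R s t → depth s + depth t = depth p + depth q →
      cls E t ≤ cls E s := by
    intro s t hs ht hst hd
    refine ht.cls_le fun a t' ht' => ?_
    obtain ⟨P, Q, hP, hQ, hdP, hdQ, hPQ, h₁, h₂⟩ := h s t hs ht hst a t' ht'
    refine h₁.trans ?_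
    rwa [← ih _ (by omega) hP hQ hPQ rfl]
  exact (key q p hq hp (hR _ _ hpq) (add_comm _ _)).antisymm (key p q hp hq hpq rfl)

theorem initials_listSum (l : List (Term A)) :
    initials (listSum l) = {c | ∃ t ∈ l, c ∈ initials t} := by
  ext c
  simp only [initials, step_listSum, Set.mem_ofPred_eq]
  exact ⟨fun ⟨r, t, h, h'⟩ => ⟨t, h, r, h'⟩, fun ⟨t, h, r, h'⟩ => ⟨r, t, h, h'⟩⟩

end BasicClasses

/-! ### Completeness for ready traces and failure traces -/

section TraceCompleteness

variable {E : Set (Equation A)} [hE : Fact (axE0 A ⊆ E)]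

theorem isReadyTrace_listSum {l : List (Term A)} (hl : ∃ t, t ∈ l) {B : Set A}
    (hB : ∀ t ∈ l, initials t = B) (X : Set A) (m : List (A × Set A)) :
    IsReadyTrace (listSum l) X m ↔ ∃ t ∈ l, IsReadyTrace t X m := by
  have : Nonempty {t // t ∈ l} := let ⟨t, ht⟩ := hl; ⟨⟨t, ht⟩⟩
  have hI : initials (listSum l) = B := by
    obtain ⟨t, ht⟩ := hl
    rw [initials_listSum]
    exact Set.ext fun c => ⟨fun ⟨s, hs, hc⟩ => hB s hs ▸ hc, fun hc => ⟨t, ht, (hB t ht).symm ▸ hc⟩⟩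
  rw [isReadyTrace_of_step_iff (t := fun t : {t // t ∈ l} => t.1)
    (fun c r => by simp [step_listSum]) fun t => by rw [hI, hB t.1 t.2]]
  simp

/-- The sum of the a-derivatives with initials I(q') has as ready traces the tails, after a, of
those traces of the whole term whose second set is I(q'). Hence equivalent terms yield equivalent
sums. -/
theorem cls_eq_of_readyTraces (hS : SaturationLaw E)
    (hM : ∀ a p q, Basic p → Basic q → initials p = initials q →
      pre a (cls E p ⊔ cls E q) ≤ pre a (cls E p) ⊔ pre a (cls E q))
    {p q : Term A} (hp : Basic p) (hq : Basic q) (h : readyTraces p = readyTraces q) :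
    cls E p = cls E q := by
  refine cls_eq_of_absorption (fun p q => readyTraces p = readyTraces q)
    (fun p q h => h.symm) ?_ hp hq h
  clear! p q
  intro p q hp hq h a q' hq'
  obtain ⟨l, hl⟩ := hp.exists_derivatives a fun t => initials t = initials q'
  obtain ⟨m, hm⟩ := hq.exists_derivatives a fun t => initials t = initials q'
  have hqm : q' ∈ m := (hm q').2 ⟨hq', rfl⟩
  obtain ⟨p', hp'⟩ : ∃ p', p' ∈ l := by
    obtain ⟨-, p', hs, hI⟩ := (readyTraces_iff h (initials q) [(a, initials q')]).2
      ⟨rfl, q', hq', rfl⟩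
    exact ⟨p', (hl p').2 ⟨hs, hI⟩⟩
  have hp's := (hl p').1 hp'
  have key : ∀ {p : Term A} {l : List (Term A)},
      (∀ t, t ∈ l ↔ Step p a t ∧ initials t = initials q') → (∃ t, t ∈ l) → ∀ X k,
      IsReadyTrace (listSum l) X k ↔
        X = initials q' ∧ IsReadyTrace p (initials p) ((a, X) :: k) := by
    intro p l hl hne X k
    rw [isReadyTrace_listSum hne (fun t ht => ((hl t).1 ht).2)]
    simp only [hl]
    exact ⟨fun ⟨t, ⟨ht, hI⟩, hk⟩ => ⟨hk.initials_eq.symm.trans hI, rfl, t, ht, hk⟩,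
      fun ⟨hX, _, t, ht, hk⟩ => ⟨t, ⟨ht, hk.initials_eq.trans hX⟩, hk⟩⟩
  have hbm : Basic (listSum m) := .listSum fun t ht => (hq.step ((hm t).1 ht).1).1
  refine ⟨listSum l, listSum m, .listSum fun t ht => (hp.step ((hl t).1 ht).1).1, hbm,
    depth_listSum_lt (Nat.zero_lt_of_lt (hp.step hp's.1).2) fun t ht =>
      (hp.step ((hl t).1 ht).1).2,
    depth_listSum_lt (Nat.zero_lt_of_lt (hq.step hq').2) fun t ht =>
      (hq.step ((hm t).1 ht).1).2,
    readyTraces_ext fun X k => ?_, ?_, ?_⟩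
  · rw [key hl ⟨p', hp'⟩, key hm ⟨q', hqm⟩, readyTraces_iff h, initials_eq_of_readyTraces h]
  · refine hS.pre_le (hq.step hq').1 hbm ?_ (cls_le_listSum hqm) a
    rw [initials_listSum]
    rintro c ⟨t, ht, hc⟩
    rwa [((hm t).1 ht).2] at hc
  -- Start from the summand ap' of p and merge the other derivatives in, one at a time.
  · rw [← sup_eq_right.2 (cls_le_listSum (E := E) hp')]
    refine pre_sup_listSum_le (fun r => Basic r ∧ initials r = initials q') ?_
      ⟨(hp.step hp's.1).1, hp's.2⟩ (hp.pre_le hp's.1)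
    rintro r ⟨hr, hI⟩ hz t ht
    obtain ⟨hst, hIt⟩ := (hl t).1 ht
    have hbt := (hp.step hst).1
    exact ⟨⟨hr.alt hbt, by simp [hI, hIt]⟩,
      (hM a r t hr hbt (hI.trans hIt.symm)).trans (sup_le hz (hp.pre_le hst))⟩

/-- A single summand may refuse more than the sum. Replacing the first refusal set by the complement
of `B`, which every summand refuses, makes the remainder of the trace independent of `X`. -/
theorem isFailureTrace_listSum {l : List (Term A)} (hl : ∃ t, t ∈ l) {B : Set A}
    (hB : initials (listSum l) = B) (X : Set A) (m : List (A × Set A)) :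
    IsFailureTrace (listSum l) X m ↔ B ∩ X = ∅ ∧ ∃ t ∈ l, IsFailureTrace t Bᶜ m := by
  have hsub : ∀ t ∈ l, initials t ∩ Bᶜ = ∅ := fun t ht =>
    Set.disjoint_iff_inter_eq_empty.1 (Set.disjoint_compl_right_iff_subset.2
      (by rw [← hB, initials_listSum]; exact fun c hc => ⟨t, ht, hc⟩))
  cases m with
  | nil =>
    simp only [IsFailureTrace, hB]
    exact (and_iff_left (hl.imp fun t ht => ⟨ht, hsub t ht⟩)).symm
  | cons x m =>
    simp only [IsFailureTrace, hB, step_listSum]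
    exact and_congr_right fun _ => ⟨fun ⟨r, ⟨t, ht, hr⟩, hm⟩ => ⟨t, ht, hsub t ht, r, hr, hm⟩,
      fun ⟨t, ht, _, r, hr, hm⟩ => ⟨r, ⟨t, ht, hr⟩, hm⟩⟩

theorem inter_compl_eq_empty {B C : Set A} : C ∩ Bᶜ = ∅ ↔ C ⊆ B := by
  rw [← Set.disjoint_iff_inter_eq_empty, Set.disjoint_compl_right_iff_subset]

/-- Refusing the complement of I(q') after a selects the derivatives with initials inside I(q'), and
equality of initials cannot be observed. Unconditional merging makes inclusion enough. -/
theorem cls_eq_of_failureTraces (hS : SaturationLaw E)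
    (hM : ∀ (a : A) (x y : Cls E), pre a (x ⊔ y) ≤ pre a x ⊔ pre a y)
    {p q : Term A} (hp : Basic p) (hq : Basic q) (h : failureTraces p = failureTraces q) :
    cls E p = cls E q := by
  refine cls_eq_of_absorption (fun p q => failureTraces p = failureTraces q)
    (fun p q h => h.symm) ?_ hp hq h
  clear! p q
  intro p q hp hq h a q' hq'
  obtain ⟨l, hl⟩ := hp.exists_derivatives a fun t => initials t ⊆ initials q'
  obtain ⟨m, hm⟩ := hq.exists_derivatives a fun t => initials t ⊆ initials q'
  have hqm : q' ∈ m := (hm q').2 ⟨hq', subset_rfl⟩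
  have key : ∀ {p : Term A} {l : List (Term A)},
      (∀ t, t ∈ l ↔ Step p a t ∧ initials t ⊆ initials q') → ∀ k,
      (∃ t ∈ l, IsFailureTrace t (initials q')ᶜ k) ↔
        IsFailureTrace p ∅ ((a, (initials q')ᶜ) :: k) := by
    intro p l hl k
    simp only [hl]
    exact ⟨fun ⟨t, ⟨ht, _⟩, hk⟩ => ⟨by simp, t, ht, hk⟩,
      fun ⟨_, t, ht, hk⟩ => ⟨t, ⟨ht, inter_compl_eq_empty.1 hk.inter_eq⟩, hk⟩⟩
  have key' : ∀ k, (∃ t ∈ l, IsFailureTrace t (initials q')ᶜ k) ↔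
      ∃ t ∈ m, IsFailureTrace t (initials q')ᶜ k := fun k => by
    rw [key hl, key hm, failureTraces_iff h]
  obtain ⟨p', hp', -⟩ := (key' []).2 ⟨q', hqm, inter_compl_eq_empty.2 subset_rfl⟩
  have hp's := (hl p').1 hp'
  have hIm : initials (listSum m) = initials q' := by
    rw [initials_listSum]
    exact Set.ext fun c => ⟨fun ⟨t, ht, hc⟩ => ((hm t).1 ht).2 hc, fun hc => ⟨q', hqm, hc⟩⟩
  have hIl : initials (listSum l) = initials q' := by
    rw [initials_listSum]
    refine Set.ext fun c => ⟨fun ⟨t, ht, hc⟩ => ((hl t).1 ht).2 hc, fun ⟨r, hr⟩ => ?_⟩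
    -- The empty refusal set is always refused, so the matching trace just exhibits a c-step.
    obtain ⟨t, ht, -, s, hs, -⟩ := (key' [(c, ∅)]).2
      ⟨q', hqm, inter_compl_eq_empty.2 subset_rfl, r, hr, by simp [IsFailureTrace]⟩
    exact ⟨t, ht, s, hs⟩
  have hbm : Basic (listSum m) := .listSum fun t ht => (hq.step ((hm t).1 ht).1).1
  refine ⟨listSum l, listSum m, .listSum fun t ht => (hp.step ((hl t).1 ht).1).1, hbm,
    depth_listSum_lt (Nat.zero_lt_of_lt (hp.step hp's.1).2) fun t ht =>
      (hp.step ((hl t).1 ht).1).2,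
    depth_listSum_lt (Nat.zero_lt_of_lt (hq.step hq').2) fun t ht =>
      (hq.step ((hm t).1 ht).1).2,
    failureTraces_ext fun X k => ?_, ?_, ?_⟩
  · rw [isFailureTrace_listSum ⟨p', hp'⟩ hIl, isFailureTrace_listSum ⟨q', hqm⟩ hIm, key']
  · exact hS.pre_le (hq.step hq').1 hbm hIm.subset (cls_le_listSum hqm) a
  · rw [← sup_eq_right.2 (cls_le_listSum (E := E) hp')]
    refine pre_sup_listSum_le (fun _ => True) ?_ trivial (hp.pre_le hp's.1)
    intro r _ hz t ht
    exact ⟨trivial, (hM a _ _).trans (sup_le hz (hp.pre_le ((hl t).1 ht).1))⟩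

end TraceCompleteness

/-! ### Completeness for ready pairs and failure pairs -/

section PairCompleteness

variable {E : Set (Equation A)} [hE : Fact (axE0 A ⊆ E)]

theorem cls_le_of_second_summands {p p' : Term A} {a : A} {B : Set A} {l : List (Term A)}
    (hp : Basic p)
    (hl : ∀ t, t ∈ l ↔ ∃ b ∈ B, ∃ p' r, Step p a p' ∧ Step p' b r ∧ t = act b r)
    (hp' : Step p a p') (hI : initials p' ⊆ B) : cls E p' ≤ cls E (listSum l) :=
  (hp.step hp').1.cls_le fun c r hr =>
    cls_le_listSum (t := act c r) ((hl _).2 ⟨c, hI ⟨r, hr⟩, p', r, hp', hr, rfl⟩)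

theorem step_second_summands {p r : Term A} {a b : A} {B : Set A} {l : List (Term A)}
    (hl : ∀ t, t ∈ l ↔ ∃ b ∈ B, ∃ p' r, Step p a p' ∧ Step p' b r ∧ t = act b r) :
    Step (listSum l) b r ↔ b ∈ B ∧ ∃ p', Step p a p' ∧ Step p' b r := by
  simp only [step_listSum, hl]
  constructor
  · rintro ⟨_, ⟨c, hc, p', s, h, h', rfl⟩, hs⟩
    obtain ⟨rfl, rfl⟩ := step_act.1 hs
    exact ⟨hc, p', h, h'⟩
  · rintro ⟨hb, p', h, h'⟩
    exact ⟨_, ⟨b, hb, p', r, h, h', rfl⟩, .act _ _⟩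

theorem second_summands_basic {p : Term A} {a : A} {B : Set A} {l : List (Term A)}
    (hp : Basic p) (hd : 0 < depth p)
    (hl : ∀ t, t ∈ l ↔ ∃ b ∈ B, ∃ p' r, Step p a p' ∧ Step p' b r ∧ t = act b r) :
    Basic (listSum l) ∧ depth (listSum l) < depth p := by
  refine ⟨.listSum fun t ht => ?_, depth_listSum_lt hd fun t ht => ?_⟩ <;>
    obtain ⟨b, -, p', r, h, h', rfl⟩ := (hl t).1 ht
  · exact ((hp.step h).1.step h').1.act b
  · exact (Nat.succ_le_of_lt ((hp.step h).1.step h').2).trans_lt (hp.step h).2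

/-- Ready pairs record initials only at the end of a run, so the continuations br of all
a-derivatives can be pooled, whatever the initials of the derivative they come from. Only b in I(q')
is kept, so that the pooled sum has initials I(q'). -/
theorem cls_eq_of_readyPairs (hS : SaturationLaw E)
    (hM : ∀ (a b : A) (x y z w : Cls E), pre a (pre b x ⊔ pre b y ⊔ z) ≤
      pre a (pre b x ⊔ z) ⊔ pre a (pre b y ⊔ w))
    {p q : Term A} (hp : Basic p) (hq : Basic q) (h : readyPairs p = readyPairs q) :
    cls E p = cls E q := by
  refine cls_eq_of_absorption (fun p q => readyPairs p = readyPairs q)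
    (fun p q h => h.symm) ?_ hp hq h
  clear! p q
  intro p q hp hq h a q' hq'
  obtain ⟨l, hl⟩ := hp.exists_second_summands a (initials q')
  obtain ⟨m, hm⟩ := hq.exists_second_summands a (initials q')
  have mem : ∀ {p : Term A} {l : List (Term A)},
      (∀ t, t ∈ l ↔ ∃ b ∈ initials q', ∃ p' r, Step p a p' ∧ Step p' b r ∧ t = act b r) →
      ∀ b α X, (b :: α, X) ∈ readyPairs (listSum l) ↔
        b ∈ initials q' ∧ (a :: b :: α, X) ∈ readyPairs p := by
    intro p l hl b α X
    simp only [cons_mem_readyPairs, step_second_summands hl]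
    exact ⟨fun ⟨r, ⟨hb, p', h, h'⟩, hr⟩ => ⟨hb, p', h, r, h', hr⟩,
      fun ⟨hb, p', h, r, h', hr⟩ => ⟨r, ⟨hb, p', h, h'⟩, hr⟩⟩
  obtain ⟨p', hp', hI⟩ : ∃ p', Step p a p' ∧ initials p' = initials q' := by
    have : ([a], initials q') ∈ readyPairs q :=
      cons_mem_readyPairs.2 ⟨q', hq', nil_mem_readyPairs.2 rfl⟩
    rw [← h, cons_mem_readyPairs] at this
    simpa [nil_mem_readyPairs] using this
  have hI' : ∀ {p p' : Term A} {l : List (Term A)},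
      (∀ t, t ∈ l ↔ ∃ b ∈ initials q', ∃ p' r, Step p a p' ∧ Step p' b r ∧ t = act b r) →
      Step p a p' → initials p' = initials q' → initials (listSum l) = initials q' := by
    intro p p' l hl hp' hI
    refine Set.ext fun c => ⟨fun ⟨r, hr⟩ => ((step_second_summands hl).1 hr).1, fun hc => ?_⟩
    obtain ⟨r, hr⟩ := hI.symm ▸ hc
    exact ⟨r, (step_second_summands hl).2 ⟨hc, p', hp', hr⟩⟩
  obtain ⟨hbl, hdl⟩ := second_summands_basic hp (Nat.zero_lt_of_lt (hp.step hp').2) hl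
  obtain ⟨hbm, hdm⟩ := second_summands_basic hq (Nat.zero_lt_of_lt (hq.step hq').2) hm
  refine ⟨listSum l, listSum m, hbl, hbm, hdl, hdm, readyPairs_ext fun α X => ?_, ?_, ?_⟩
  · cases α with
    | nil => rw [nil_mem_readyPairs, nil_mem_readyPairs, hI' hl hp' hI, hI' hm hq' rfl]
    | cons b α => rw [mem hl, mem hm, h]
  · exact hS.pre_le (hq.step hq').1 hbm (hI' hm hq' rfl).subset
      (cls_le_of_second_summands hq hm hq' subset_rfl) a
  · rw [← sup_eq_right.2 (cls_le_of_second_summands (E := E) hp hl hp' hI.subset)]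
    refine pre_sup_listSum_le (fun r => Basic r ∧ initials r = initials q') ?_
      ⟨(hp.step hp').1, hI⟩ (hp.pre_le hp')
    rintro r ⟨hr, hIr⟩ hz t ht
    obtain ⟨b, hb, s, y, hs, hy, rfl⟩ := (hl t).1 ht
    refine ⟨⟨hr.alt (((hp.step hs).1.step hy).1.act b), by simpa [hIr] using hb⟩, ?_⟩
    obtain ⟨x, hx⟩ := hIr.symm ▸ hb
    -- Since bx ≤ r and by ≤ s, taking z = r and w = s turns the law into a(r + by) ≤ ar + as.
    have := hM a b (cls E x) (cls E y) (cls E r) (cls E s)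
    rw [sup_right_comm, sup_eq_right.2 (hr.pre_le hx),
      sup_eq_right.2 ((hp.step hs).1.pre_le hy)] at this
    exact this.trans (sup_le hz (hp.pre_le hs))

/-- The pooling is as for ready pairs, but failures only provide an a-derivative of p with initials
inside I(q'). That suffices, because `hM` merges without any condition on initials. -/
theorem cls_eq_of_failurePairs (hS : SaturationLaw E)
    (hM : ∀ (a : A) (x y z : Cls E), pre a (x ⊔ y) ≤ pre a x ⊔ pre a (y ⊔ z))
    {p q : Term A} (hp : Basic p) (hq : Basic q) (h : failurePairs p = failurePairs q) :
    cls E p = cls E q := by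
  refine cls_eq_of_absorption (fun p q => failurePairs p = failurePairs q)
    (fun p q h => h.symm) ?_ hp hq h
  clear! p q
  intro p q hp hq h a q' hq'
  obtain ⟨l, hl⟩ := hp.exists_second_summands a (initials q')
  obtain ⟨m, hm⟩ := hq.exists_second_summands a (initials q')
  have mem : ∀ {p : Term A} {l : List (Term A)},
      (∀ t, t ∈ l ↔ ∃ b ∈ initials q', ∃ p' r, Step p a p' ∧ Step p' b r ∧ t = act b r) →
      ∀ b α X, (b :: α, X) ∈ failurePairs (listSum l) ↔
        b ∈ initials q' ∧ (a :: b :: α, X) ∈ failurePairs p := by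
    intro p l hl b α X
    simp only [cons_mem_failurePairs, step_second_summands hl]
    exact ⟨fun ⟨r, ⟨hb, p', h, h'⟩, hr⟩ => ⟨hb, p', h, r, h', hr⟩,
      fun ⟨hb, p', h, r, h', hr⟩ => ⟨r, ⟨hb, p', h, h'⟩, hr⟩⟩
  obtain ⟨p', hp', hI⟩ : ∃ p', Step p a p' ∧ initials p' ⊆ initials q' := by
    have : ([a], (initials q')ᶜ) ∈ failurePairs q :=
      cons_mem_failurePairs.2 ⟨q', hq', nil_mem_failurePairs.2 (inter_compl_eq_empty.2 subset_rfl)⟩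
    rw [← h, cons_mem_failurePairs] at this
    simpa only [nil_mem_failurePairs, inter_compl_eq_empty] using this
  have hI' : ∀ {p : Term A} {l : List (Term A)},
      (∀ t, t ∈ l ↔ ∃ b ∈ initials q', ∃ p' r, Step p a p' ∧ Step p' b r ∧ t = act b r) →
      failurePairs p = failurePairs q → initials (listSum l) = initials q' := by
    intro p l hl h
    refine Set.ext fun c => ⟨fun ⟨r, hr⟩ => ((step_second_summands hl).1 hr).1, fun ⟨r, hr⟩ => ?_⟩
    -- With the empty refusal set, a failure pair says only that the word ac can be performed.
    have : ([a, c], ∅) ∈ failurePairs q := cons_mem_failurePairs.2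
      ⟨q', hq', cons_mem_failurePairs.2 ⟨r, hr, nil_mem_failurePairs.2 (Set.inter_empty _)⟩⟩
    rw [← h, cons_mem_failurePairs] at this
    obtain ⟨s, hs, hc⟩ := this
    obtain ⟨v, hv, -⟩ := cons_mem_failurePairs.1 hc
    exact ⟨v, (step_second_summands hl).2 ⟨⟨r, hr⟩, s, hs, hv⟩⟩
  obtain ⟨hbl, hdl⟩ := second_summands_basic hp (Nat.zero_lt_of_lt (hp.step hp').2) hl
  obtain ⟨hbm, hdm⟩ := second_summands_basic hq (Nat.zero_lt_of_lt (hq.step hq').2) hm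
  refine ⟨listSum l, listSum m, hbl, hbm, hdl, hdm, failurePairs_ext fun α X => ?_, ?_, ?_⟩
  · cases α with
    | nil => rw [nil_mem_failurePairs, nil_mem_failurePairs, hI' hl h, hI' hm rfl]
    | cons b α => rw [mem hl, mem hm, h]
  · exact hS.pre_le (hq.step hq').1 hbm (hI' hm rfl).subset
      (cls_le_of_second_summands hq hm hq' subset_rfl) a
  · rw [← sup_eq_right.2 (cls_le_of_second_summands (E := E) hp hl hp' hI)]
    refine pre_sup_listSum_le (fun _ => True) ?_ trivial (hp.pre_le hp')
    intro r _ hz t ht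
    obtain ⟨b, hb, s, y, hs, hy, rfl⟩ := (hl t).1 ht
    have := hM a (cls E r) (pre b (cls E y)) (cls E s)
    rw [sup_eq_right.2 ((hp.step hs).1.pre_le hy)] at this
    exact ⟨trivial, this.trans (sup_le hz (hp.pre_le hs))⟩

end PairCompleteness

/-! ### Saturation and merging laws from the axioms -/

section AxiomLaws

variable {E : Set (Equation A)} [hE : Fact (axE0 A ⊆ E)]

theorem saturationLaw_of_axRS (h : axRS A ⊆ E) : SaturationLaw E := fun a b x y z => by
  have := ev_eq (h ⟨a, b, rfl⟩) fun n => if n = 0 then x else if n = 1 then y else z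
  simpa using this

theorem pre_sup_le_of_axFT (h : axFT A ⊆ E) (a : A) (x y : Cls E) :
    pre a (x ⊔ y) ≤ pre a x ⊔ pre a y := by
  have := ev_eq (h ⟨a, rfl⟩) fun n => if n = 0 then x else y
  simpa using this

theorem pre_sup_le_of_axF (h : axF A ⊆ E) (a : A) (x y z : Cls E) :
    pre a (x ⊔ y) ≤ pre a x ⊔ pre a (y ⊔ z) := by
  have := ev_eq (h ⟨a, rfl⟩) fun n => if n = 0 then x else if n = 1 then y else z
  simp only [ev_alt, ev_act, ev_var, if_true, one_ne_zero, if_false, OfNat.ofNat_ne_zero,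
    OfNat.ofNat_ne_one] at this
  rw [this]
  exact le_sup_of_le_left le_sup_right

theorem pre_sup_eq_of_axR (h : axR A ⊆ E) (a b : A) (x y z w : Cls E) :
    pre a (pre b x ⊔ z) ⊔ pre a (pre b y ⊔ w) =
      pre a (pre b x ⊔ pre b y ⊔ z) ⊔ pre a (pre b y ⊔ w) := by
  have := ev_eq (h ⟨a, b, rfl⟩) fun n =>
    if n = 0 then x else if n = 1 then y else if n = 2 then z else w
  simpa using this

theorem saturationLaw_of_axR (h : axR A ⊆ E) : SaturationLaw E := fun a b x y z => by
  -- With w = bx + z both summands on the right of R become a(bx + by + z).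
  have := pre_sup_eq_of_axR h a b x y z (pre b x ⊔ z)
  rw [sup_left_comm (pre b y), ← sup_assoc (pre b x), sup_idem] at this
  exact this ▸ le_sup_left

theorem pre_sup_eq_of_axRT [Fintype A] (h : axRT A ⊆ E) (a : A)
    (b : Fin (Fintype.card A) → A) (x y : Fin (Fintype.card A) → Cls E) (z : Cls E) :
    pre a ((Finset.univ.sup fun i => pre (b i) (x i) ⊔ pre (b i) (y i)) ⊔ z) =
      pre a ((Finset.univ.sup fun i => pre (b i) (x i)) ⊔ z) ⊔
      pre a ((Finset.univ.sup fun i => pre (b i) (y i)) ⊔ z) := by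
  -- The names 2i + 1 and 2i + 2 decode to `x i` and `y i`; the default ⊥ is never used.
  have := ev_eq (h ⟨a, b, rfl⟩) fun n => if n = 0 then z else
    if n % 2 = 1 then if h : n / 2 < Fintype.card A then x ⟨n / 2, h⟩ else ⊥
    else if h : n / 2 - 1 < Fintype.card A then y ⟨n / 2 - 1, h⟩ else ⊥
  have h₁ : ∀ i : ℕ, (2 * i + 1) % 2 = 1 := by omega
  have h₂ : ∀ i : ℕ, (2 * i + 1) / 2 = i := by omega
  have h₃ : ∀ i : ℕ, (2 * i + 2) % 2 = 0 := by omega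
  have h₄ : ∀ i : ℕ, (2 * i + 2) / 2 = i + 1 := by omega
  simpa [h₁, h₂, h₃, h₄] using this

/-- Constant families collapse the sums in RT by idempotence; there is at least one index because
`a` exists. -/
theorem pre_sup_eq_of_axRT_const [Fintype A] (h : axRT A ⊆ E) (a b : A) (x y z : Cls E) :
    pre a (pre b x ⊔ pre b y ⊔ z) = pre a (pre b x ⊔ z) ⊔ pre a (pre b y ⊔ z) := by
  have : Nonempty (Fin (Fintype.card A)) := ⟨⟨0, Fintype.card_pos_iff.2 ⟨a⟩⟩⟩
  simpa [Finset.sup_const] using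
    pre_sup_eq_of_axRT h a (fun _ => b) (fun _ => x) (fun _ => y) z

theorem saturationLaw_of_axRT [Fintype A] (h : axRT A ⊆ E) : SaturationLaw E :=
  fun a b x y z => pre_sup_eq_of_axRT_const h a b x y z ▸ le_sup_left

theorem image_fst_erase [DecidableEq (A × Term A)] {S : Finset (A × Term A)} {s t : A × Term A}
    (hs : s ∈ S) (hst : s ≠ t) (h1 : s.1 = t.1) :
    Prod.fst '' (S.erase t : Set (A × Term A)) = Prod.fst '' (S : Set (A × Term A)) := by
  refine (Set.image_mono (by simp)).antisymm ?_
  rintro _ ⟨v, hv, rfl⟩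
  by_cases hvt : v = t
  · exact ⟨s, by simp [hs, hst], by rw [h1, hvt]⟩
  · exact ⟨v, by simpa [hvt] using hv, rfl⟩

/-- If every action labels at most one summand of `S` and of `T`, this is one instance of RT with z
= 0. A repeated action is first separated by the one-action instance of RT, which leaves fewer
summands; saturation then restores the removed summand under the prefix. -/
theorem pre_val_sup_le_of_axRT [Fintype A] (h : axRT A ⊆ E) (a : A) (S T : Finset (A × Term A))
    (hST : Prod.fst '' (S : Set (A × Term A)) = Prod.fst '' (T : Set (A × Term A))) :
    pre a (val E S ⊔ val E T) ≤ pre a (val E S) ⊔ pre a (val E T) := by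
  classical
  induction hn : S.card + T.card using Nat.strong_induction_on generalizing S T with
  | _ n ih =>
  have split : ∀ S T : Finset (A × Term A),
      Prod.fst '' (S : Set (A × Term A)) = Prod.fst '' (T : Set (A × Term A)) →
      S.card + T.card = n → ¬ Set.InjOn Prod.fst (S : Set (A × Term A)) →
      pre a (val E S ⊔ val E T) ≤ pre a (val E S) ⊔ pre a (val E T) := by
    intro S T hST hn hS
    simp only [Set.InjOn, not_forall] at hS
    obtain ⟨s, hs, t, ht, h1, hst⟩ := hS
    -- One of the two branches after separation: `t` is dropped while `s` keeps its action
    -- available, so `S` and `T` still have the same actions.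
    have half : ∀ s t, s ∈ S → t ∈ S → s.1 = t.1 → s ≠ t →
        pre a (pre s.1 (cls E s.2) ⊔ (val E ((S.erase s).erase t) ⊔ val E T)) ≤
          pre a (val E S) ⊔ pre a (val E T) := by
      intro s t hs ht h1 hst
      have hs' : s ∈ S.erase t := Finset.mem_erase.2 ⟨hst, hs⟩
      have hlt := Finset.card_erase_lt_of_mem ht
      have := ih _ (by omega) (S.erase t) T ((image_fst_erase hs hst h1).trans hST) rfl
      rw [← sup_assoc, Finset.erase_right_comm, ← sup_eq_of_mem hs']
      refine this.trans (sup_le_sup_right ?_ _)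
      rw [sup_eq_of_mem ht, sup_eq_of_mem hs', h1, ← sup_assoc,
        sup_comm (pre t.1 (cls E t.2)) (pre t.1 (cls E s.2))]
      exact saturationLaw_of_axRT h a t.1 (cls E s.2) (cls E t.2) _
    have ht' : t ∈ S.erase s := Finset.mem_erase.2 ⟨Ne.symm hst, ht⟩
    have hval : val E S ⊔ val E T = pre s.1 (cls E s.2) ⊔ pre s.1 (cls E t.2) ⊔
        (val E ((S.erase s).erase t) ⊔ val E T) := by
      rw [sup_eq_of_mem hs, sup_eq_of_mem ht', ← h1, ← sup_assoc, sup_assoc]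
    rw [hval, pre_sup_eq_of_axRT_const h]
    refine sup_le (half s t hs ht h1 hst) ?_
    rw [Finset.erase_right_comm, h1]
    exact half t s ht hs h1.symm (Ne.symm hst)
  by_cases hS : Set.InjOn Prod.fst (S : Set (A × Term A))
  swap
  · exact split S T hST hn hS
  by_cases hT : Set.InjOn Prod.fst (T : Set (A × Term A))
  swap
  · rw [sup_comm, sup_comm (pre a (val E S))]
    exact split T S hST.symm (by omega) hT
  set I := Prod.fst '' (S : Set (A × Term A)) with hI
  rcases I.eq_empty_or_nonempty with hemp | ⟨b₀, hb₀⟩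
  · have h₁ : S = ∅ := by simpa [hI] using hemp
    have h₂ : T = ∅ := by simpa [hST] using hemp
    simp [h₁, h₂, val]
  have hx : ∀ b ∈ I, ∃ x, (b, x) ∈ S := by
    rintro _ ⟨⟨b, x⟩, hs, rfl⟩
    exact ⟨x, hs⟩
  have hy : ∀ b ∈ I, ∃ y, (b, y) ∈ T := by
    rw [hST]
    rintro _ ⟨⟨b, x⟩, hs, rfl⟩
    exact ⟨x, hs⟩
  have : Nonempty (Term A) := ⟨nil⟩
  choose! x hx using hx
  choose! y hy using hy
  let e := Fintype.equivFin A
  -- RT needs exactly |A| actions; indices outside `I` repeat `b₀`, which idempotence makes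
  -- harmless.
  let b : Fin (Fintype.card A) → A := fun i => if e.symm i ∈ I then e.symm i else b₀
  have hb : ∀ i, b i ∈ I := fun i => by
    by_cases hi : e.symm i ∈ I <;> simp [b, hi, hb₀]
  have hval : ∀ (S : Finset (A × Term A)) (x : A → Term A), (∀ b ∈ I, (b, x b) ∈ S) →
      Set.InjOn Prod.fst (S : Set (A × Term A)) → I = Prod.fst '' (S : Set (A × Term A)) →
      (Finset.univ.sup fun i => pre (b i) (cls E (x (b i)))) = val E S := by
    intro S x hx hS hIS
    refine le_antisymm (Finset.sup_le fun i _ =>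
      Finset.le_sup (f := fun s : A × Term A => pre s.1 (cls E s.2)) (hx _ (hb i)))
      (Finset.sup_le fun s hs => ?_)
    have hs1 : s.1 ∈ I := hIS ▸ ⟨s, hs, rfl⟩
    have hbs : b (e s.1) = s.1 := by simp [b, hs1]
    have : (s.1, x s.1) = s := hS (hx _ hs1) hs rfl
    have hsx : x s.1 = s.2 := congrArg Prod.snd this
    have := Finset.le_sup (f := fun i => pre (b i) (cls E (x (b i)))) (Finset.mem_univ (e s.1))
    rwa [hbs, hsx] at this
  have := pre_sup_eq_of_axRT h a b (fun i => cls E (x (b i))) (fun i => cls E (y (b i))) ⊥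
  rw [show (fun i => pre (b i) (cls E (x (b i))) ⊔ pre (b i) (cls E (y (b i)))) =
    (fun i => pre (b i) (cls E (x (b i)))) ⊔ fun i => pre (b i) (cls E (y (b i))) from rfl,
    Finset.sup_sup, hval S x hx hS hI, hval T y hy hT hST] at this
  simp only [sup_bot_eq] at this
  exact this.le

theorem pre_sup_le_of_axRT [Fintype A] (h : axRT A ⊆ E) (a : A) {p q : Term A} (hp : Basic p)
    (hq : Basic q) (hI : initials p = initials q) :
    pre a (cls E p ⊔ cls E q) ≤ pre a (cls E p) ⊔ pre a (cls E q) := by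
  obtain ⟨S, -, -, hv, hi⟩ := hp.exists_summands (E := E)
  obtain ⟨T, -, -, hv', hi'⟩ := hq.exists_summands (E := E)
  rw [← hv, ← hv']
  exact pre_val_sup_le_of_axRT h a S T (by rw [hi, hi', hI])

end AxiomLaws

/-! ### Ground-completeness -/

section Completeness

theorem axSystem_subset [Fintype A] (X : Sem) :
    axE1 A ⊆ axSystem A X ∧ axFP A ⊆ axSystem A X ∧ axEL2 A ⊆ axSystem A X := by
  cases X <;> exact ⟨fun e he => by simp [axSystem, he], fun e he => by simp [axSystem, he],
    fun e he => by simp [axSystem, he]⟩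

theorem derives_of_semEquiv [Fintype A] (X : Sem) {p q : Term A} (hp : p.Closed) (hq : q.Closed)
    (h : SemEquiv X p q) : Derives (axSystem A X) p q := by
  obtain ⟨h₁, h₂, h₃⟩ := axSystem_subset (A := A) X
  have : Fact (axE0 A ⊆ axSystem A X) := ⟨fun e he => h₁ (.inl he)⟩
  obtain ⟨r, hr, hpr⟩ := exists_basic h₁ h₂ h₃ p hp
  obtain ⟨s, hs, hqs⟩ := exists_basic h₁ h₂ h₃ q hq
  -- Soundness carries the equivalence over to the ‖-free forms.
  have hrs : SemEquiv X r s :=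
    ((cls_eq_iff.1 hpr).semEquiv (semEquiv_of_mem_axSystem X)).trans
      (h.trans ((cls_eq_iff.1 hqs).semEquiv (semEquiv_of_mem_axSystem X)).symm)
  rw [← cls_eq_iff, ← hpr, ← hqs]
  cases X with
  | RT =>
    have hRT : axRT A ⊆ axSystem A Sem.RT := fun e he => by simp [axSystem, he]
    exact cls_eq_of_readyTraces (saturationLaw_of_axRT hRT)
      (fun a p q hp hq hI => pre_sup_le_of_axRT hRT a hp hq hI) hr hs hrs
  | FT =>
    exact cls_eq_of_failureTraces (saturationLaw_of_axRS fun e he => by simp [axSystem, he])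
      (pre_sup_le_of_axFT fun e he => by simp [axSystem, he]) hr hs hrs
  | R =>
    have hR : axR A ⊆ axSystem A Sem.R := fun e he => by simp [axSystem, he]
    exact cls_eq_of_readyPairs (saturationLaw_of_axR hR)
      (fun a b x y z w => (pre_sup_eq_of_axR hR a b x y z w).symm ▸ le_sup_left) hr hs hrs
  | F =>
    exact cls_eq_of_failurePairs (saturationLaw_of_axR fun e he => by simp [axSystem, he])
      (pre_sup_le_of_axF fun e he => by simp [axSystem, he]) hr hs hrs

end Completeness

end BCCSPpar

theorem mainTheorem8 (A : Type*) [Fintype A] [Nonempty A] (X : BCCSPpar.Sem) :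
    (BCCSPpar.axSystem A X).Finite ∧
    BCCSPpar.Sound (BCCSPpar.axSystem A X) (BCCSPpar.SemEquiv X) ∧
    BCCSPpar.GroundComplete (BCCSPpar.axSystem A X) (BCCSPpar.SemEquiv X) ∧
    ∀ p q : BCCSPpar.Term A, p.Closed → q.Closed →
      (BCCSPpar.SemEquiv X p q ↔ BCCSPpar.Derives (BCCSPpar.axSystem A X) p q) :=
  ⟨BCCSPpar.finite_axSystem A X,
    fun e he σ _ => BCCSPpar.semEquiv_of_mem_axSystem X e he σ,
    fun _ _ hp hq h => BCCSPpar.derives_of_semEquiv X hp hq h,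
    fun _ _ hp hq => ⟨BCCSPpar.derives_of_semEquiv X hp hq,
      fun h => h.semEquiv (BCCSPpar.semEquiv_of_mem_axSystem X)⟩⟩
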